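/- Let $(A,\mathfrak m)$ be a (commutative) local ring and $J_1,\dots,J_s$ ideals of $A$. The mixed multiplicities $e_{\mathbf i}(\mathfrak m|J_1,\dots,J_s)$ are defined as follows: if $P$ is the polynomial with $$P(u,v_1,\dots,v_s)=\dim_{A/\mathfrak m}\ \mathfrak m^uJ_1^{v_1}\cdots J_s^{v_s}/\mathfrak m^{u+1}J_1^{v_1}\cdots J_s^{v_s}\qquad\text{for all large }u,v_1,\dots,v_s,$$ and $P$ has total degree $n$, then $$P(u,v_1,\dots,v_s)=\sum_{|\mathbf i|=n}\frac{e_{\mathbf i}(\mathfrak m|J_1,\dots,J_s)}{i_0!\,i_1!\cdots i_s!}\,u^{i_0}v_1^{i_1}\cdots v_s^{i_s}+(\text{lower degree terms}).$$ Let $A=\mathbb C\{x,y,z\}$ be the ring of convergent power series in three variables, a Noetherian local ring of dimension $3$, and let $$J_1=(xy^2,\;y^3z,\;xz),\qquad J_2=(xy^2,\;y^3z,\;xz^2).$$ Then $\operatorname{ht}(J_1)=\operatorname{ht}(J_2)=2$, and (the polynomials above exist, have total degree $2$, and) $$e_{(0,1,1)}(\mathfrak m|J_1,J_1)=1,\qquad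 e_{(0,1,1)}(\mathfrak m|J_1,J_2)=1,\qquad e_{(0,1,1)}(\mathfrak m|J_2,J_2)=2.$$ Consequently the following question of Trung and Verma has a negative answer in general: if $A$ is a Noetherian local ring of dimension $n+1\ge 3$, $J_1,\dots,J_n$ are ideals of height $n$, and $\mathbf i=(0,1,\dots,1)$, is it true that $$e_{\mathbf i}(\mathfrak m|J_1,J_1,J_3,\dots,J_n)\,e_{\mathbf i}(\mathfrak m|J_2,J_2,J_3,\dots,J_n)\le e_{\mathbf i}(\mathfrak m|J_1,J_2,J_3,\dots,J_n)^2\,?$$ -/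

import Mathlib

/-- A formal power series in `d` variables over `ℂ` is convergent if `∑ ‖aₙ‖ ρ^|n|` is finite for
some polyradius `(ρ, …, ρ)` with `ρ > 0`. -/
def IsConvergentSeries {d : ℕ} (f : MvPowerSeries (Fin d) ℂ) : Prop :=
  ∃ ρ : ℝ, 0 < ρ ∧ Summable fun n : Fin d →₀ ℕ => ‖MvPowerSeries.coeff n f‖ * ρ ^ n.degree

namespace IsConvergentSeries

variable {d : ℕ}

theorem mono {f : MvPowerSeries (Fin d) ℂ} {ρ σ : ℝ} (hσ : 0 ≤ σ) (h : σ ≤ ρ)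
    (hf : Summable fun n : Fin d →₀ ℕ => ‖MvPowerSeries.coeff n f‖ * ρ ^ n.degree) :
    Summable fun n : Fin d →₀ ℕ => ‖MvPowerSeries.coeff n f‖ * σ ^ n.degree := by
  refine Summable.of_nonneg_of_le (fun n => by positivity) (fun n => ?_) hf
  gcongr

theorem monomial (m : Fin d →₀ ℕ) (a : ℂ) :
    IsConvergentSeries (MvPowerSeries.monomial m a) := by
  classical
  refine ⟨1, one_pos, summable_of_ne_finset_zero (s := {m}) fun n hn => ?_⟩
  rw [MvPowerSeries.coeff_monomial_ne (by simpa using hn)]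
  simp

theorem add {f g : MvPowerSeries (Fin d) ℂ} (hf : IsConvergentSeries f)
    (hg : IsConvergentSeries g) : IsConvergentSeries (f + g) := by
  obtain ⟨ρ, hρ, hf⟩ := hf
  obtain ⟨σ, hσ, hg⟩ := hg
  have hτ : 0 < min ρ σ := lt_min hρ hσ
  refine ⟨min ρ σ, hτ, Summable.of_nonneg_of_le (fun n => by positivity) (fun n => ?_)
    ((mono hτ.le (min_le_left _ _) hf).add (mono hτ.le (min_le_right _ _) hg))⟩
  rw [map_add, ← add_mul]
  gcongr
  exact norm_add_le _ _

theorem mul {f g : MvPowerSeries (Fin d) ℂ} (hf : IsConvergentSeries f)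
    (hg : IsConvergentSeries g) : IsConvergentSeries (f * g) := by
  classical
  obtain ⟨ρ, hρ, hf⟩ := hf
  obtain ⟨σ, hσ, hg⟩ := hg
  have hτ : 0 < min ρ σ := lt_min hρ hσ
  have hf := mono hτ.le (min_le_left _ _) hf
  have hg := mono hτ.le (min_le_right _ _) hg
  have h0 := hf.mul_of_nonneg hg (fun n => by positivity) (fun n => by positivity)
  have h := summable_sum_mul_antidiagonal_of_summable_mul
    (f := fun n : Fin d →₀ ℕ => ‖MvPowerSeries.coeff n f‖ * min ρ σ ^ n.degree)
    (g := fun n : Fin d →₀ ℕ => ‖MvPowerSeries.coeff n g‖ * min ρ σ ^ n.degree) h0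
  refine ⟨min ρ σ, hτ, Summable.of_nonneg_of_le (fun n => by positivity) (fun n => ?_) h⟩
  rw [MvPowerSeries.coeff_mul]
  calc ‖∑ p ∈ Finset.HasAntidiagonal.antidiagonal n, MvPowerSeries.coeff p.1 f * MvPowerSeries.coeff p.2 g‖
        * min ρ σ ^ n.degree
      ≤ (∑ p ∈ Finset.HasAntidiagonal.antidiagonal n,
          ‖MvPowerSeries.coeff p.1 f‖ * ‖MvPowerSeries.coeff p.2 g‖) * min ρ σ ^ n.degree := by
        gcongr
        refine (norm_sum_le _ _).trans (le_of_eq ?_)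
        simp
    _ = _ := by
        rw [Finset.sum_mul]
        refine Finset.sum_congr rfl fun p hp => ?_
        rw [← Finset.HasAntidiagonal.mem_antidiagonal.mp hp, map_add, pow_add]
        ring

/-- The inverse of a convergent power series with nonzero constant term is convergent. -/
theorem of_mul_eq_one {f g : MvPowerSeries (Fin d) ℂ} (hf : IsConvergentSeries f)
    (hfg : f * g = 1) : IsConvergentSeries g := by
  classical
  obtain ⟨ρ, hρ, hf⟩ := hf
  set c : ℂ := MvPowerSeries.coeff 0 f with hc
  have hc0 : c ≠ 0 := by
    intro h
    have := congrArg (MvPowerSeries.coeff 0) hfg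
    simp [MvPowerSeries.coeff_mul, ← hc, h] at this
  have hcpos : 0 < ‖c‖ := norm_pos_iff.mpr hc0
  set T : ℝ := ∑' n : Fin d →₀ ℕ, ‖MvPowerSeries.coeff n f‖ * ρ ^ n.degree with hT
  have hT0 : 0 ≤ T := tsum_nonneg fun n => by positivity
  obtain ⟨t, ht0, ht1, htT⟩ : ∃ t : ℝ, 0 < t ∧ t ≤ 1 ∧ t * T ≤ ‖c‖ / 2 := by
    refine ⟨min 1 (‖c‖ / 2 / (T + 1)), by positivity, min_le_left _ _, ?_⟩
    calc min 1 (‖c‖ / 2 / (T + 1)) * T ≤ ‖c‖ / 2 / (T + 1) * (T + 1) := by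
          gcongr
          · exact min_le_right _ _
          · linarith
      _ = ‖c‖ / 2 := by field_simp
  set σ := t * ρ with hσ
  have hσ0 : 0 < σ := by positivity
  set a : (Fin d →₀ ℕ) → ℝ := fun n =>
    if n = 0 then 0 else ‖MvPowerSeries.coeff n f‖ * σ ^ n.degree with ha
  set b : (Fin d →₀ ℕ) → ℝ := fun n => ‖MvPowerSeries.coeff n g‖ * σ ^ n.degree with hb
  have ha0 : ∀ n, 0 ≤ a n := fun n => by simp only [ha]; split_ifs <;> positivity
  have hb0 : ∀ n, 0 ≤ b n := fun n => by simp only [hb]; positivity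
  have hale : ∀ n, a n ≤ t * (‖MvPowerSeries.coeff n f‖ * ρ ^ n.degree) := by
    intro n
    simp only [ha]
    split_ifs with h
    · positivity
    · have hn : n.degree ≠ 0 := fun h0 => h ((Finsupp.degree_eq_zero_iff n).mp h0)
      have h1 : t ^ n.degree ≤ t := pow_le_of_le_one ht0.le ht1 hn
      calc ‖MvPowerSeries.coeff n f‖ * σ ^ n.degree
          = t ^ n.degree * (‖MvPowerSeries.coeff n f‖ * ρ ^ n.degree) := by
            rw [hσ, mul_pow]; ring
        _ ≤ _ := by gcongr
  have hasum : ∀ S : Finset (Fin d →₀ ℕ), ∑ n ∈ S, a n ≤ ‖c‖ / 2 := by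
    intro S
    calc ∑ n ∈ S, a n ≤ ∑ n ∈ S, t * (‖MvPowerSeries.coeff n f‖ * ρ ^ n.degree) :=
          Finset.sum_le_sum fun n _ => hale n
      _ = t * ∑ n ∈ S, ‖MvPowerSeries.coeff n f‖ * ρ ^ n.degree := by rw [Finset.mul_sum]
      _ ≤ t * T := by
          gcongr
          exact hf.sum_le_tsum S fun n _ => by positivity
      _ ≤ _ := htT
  have hrec : ∀ n, n ≠ 0 →
      ‖c‖ * b n ≤ ∑ p ∈ Finset.HasAntidiagonal.antidiagonal n, a p.1 * b p.2 := by
    intro n hn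
    have h0 : ((0 : Fin d →₀ ℕ), n) ∈ Finset.HasAntidiagonal.antidiagonal n := by simp
    have h1 := congrArg (MvPowerSeries.coeff n) hfg
    rw [MvPowerSeries.coeff_mul, MvPowerSeries.coeff_one, if_neg hn,
      ← Finset.add_sum_erase _ _ h0] at h1
    have h2 : ‖c * MvPowerSeries.coeff n g‖ ≤
        ∑ p ∈ (Finset.HasAntidiagonal.antidiagonal n).erase (0, n),
          ‖MvPowerSeries.coeff p.1 f‖ * ‖MvPowerSeries.coeff p.2 g‖ := by
      rw [hc, eq_neg_of_add_eq_zero_left h1, norm_neg]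
      refine (norm_sum_le _ _).trans (le_of_eq ?_)
      simp
    calc ‖c‖ * b n = ‖c * MvPowerSeries.coeff n g‖ * σ ^ n.degree := by
          simp only [hb, norm_mul]; ring
      _ ≤ (∑ p ∈ (Finset.HasAntidiagonal.antidiagonal n).erase (0, n),
          ‖MvPowerSeries.coeff p.1 f‖ * ‖MvPowerSeries.coeff p.2 g‖) * σ ^ n.degree := by
          gcongr
      _ = ∑ p ∈ (Finset.HasAntidiagonal.antidiagonal n).erase (0, n), a p.1 * b p.2 := by
          rw [Finset.sum_mul]
          refine Finset.sum_congr rfl fun p hp => ?_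
          have hp1 := Finset.HasAntidiagonal.mem_antidiagonal.mp (Finset.mem_of_mem_erase hp)
          have hp0 : p.1 ≠ 0 := by
            intro h
            apply Finset.ne_of_mem_erase hp
            rw [h, zero_add] at hp1
            exact Prod.ext h hp1
          simp only [ha, hb, if_neg hp0]
          rw [← hp1, map_add, pow_add]
          ring
      _ ≤ _ := Finset.sum_le_sum_of_subset_of_nonneg (Finset.erase_subset _ _)
          fun p _ _ => mul_nonneg (ha0 _) (hb0 _)
  have hbsum : ∀ m : Fin d →₀ ℕ, ∑ n ∈ Finset.Iic m, b n ≤ 2 * b 0 := by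
    intro m
    set S := Finset.Iic m with hS
    have h0S : (0 : Fin d →₀ ℕ) ∈ S := by simp [hS]
    have h1 : ∑ n ∈ S.erase 0, ‖c‖ * b n ≤ ∑ n ∈ S, ∑ p ∈ Finset.HasAntidiagonal.antidiagonal n, a p.1 * b p.2 :=
      (Finset.sum_le_sum fun n hn => hrec n (Finset.ne_of_mem_erase hn)).trans
        (Finset.sum_le_sum_of_subset_of_nonneg (Finset.erase_subset _ _)
          fun n _ _ => Finset.sum_nonneg fun p _ => mul_nonneg (ha0 _) (hb0 _))
    have h2 : ∑ n ∈ S, ∑ p ∈ Finset.HasAntidiagonal.antidiagonal n, a p.1 * b p.2 ≤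
        ∑ p ∈ S ×ˢ S, a p.1 * b p.2 := by
      have h3 : ∀ n ∈ S, Finset.HasAntidiagonal.antidiagonal n =
          ((S ×ˢ S).filter fun p => p.1 + p.2 ∈ S).filter fun p => p.1 + p.2 = n := by
        intro n hn
        ext p
        simp only [Finset.HasAntidiagonal.mem_antidiagonal, Finset.mem_filter, Finset.mem_product]
        refine ⟨fun h => ?_, fun h => h.2⟩
        have hnm : n ≤ m := by simpa [hS] using hn
        refine ⟨⟨⟨?_, ?_⟩, h ▸ hn⟩, h⟩
        · simpa [hS] using (le_self_add.trans h.le).trans hnm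
        · simpa [hS] using (le_add_self.trans h.le).trans hnm
      rw [Finset.sum_congr rfl fun n hn => by rw [h3 n hn],
        Finset.sum_fiberwise_of_maps_to (fun p hp => (Finset.mem_filter.mp hp).2)]
      exact Finset.sum_le_sum_of_subset_of_nonneg (Finset.filter_subset _ _)
        fun p _ _ => mul_nonneg (ha0 _) (hb0 _)
    rw [Finset.sum_product, ← Finset.sum_mul_sum] at h2
    have h4 : (∑ n ∈ S, a n) * ∑ n ∈ S, b n ≤ ‖c‖ / 2 * ∑ n ∈ S, b n := by
      gcongr
      · exact hasum S
    rw [← Finset.mul_sum] at h1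
    have h5 := Finset.add_sum_erase S b h0S
    have h6 : ‖c‖ * (∑ n ∈ S, b n - b 0) ≤ ‖c‖ * (1 / 2 * ∑ n ∈ S, b n) := by
      rw [← h5, add_sub_cancel_left, h5]
      linarith
    have h7 := le_of_mul_le_mul_left h6 hcpos
    linarith
  refine ⟨σ, hσ0, summable_of_sum_le hb0 (c := 2 * b 0) fun U => ?_⟩
  refine le_trans ?_ (hbsum (U.sup id))
  exact Finset.sum_le_sum_of_subset_of_nonneg
    (fun n hn => Finset.mem_Iic.mpr (Finset.le_sup (f := id) hn)) fun n _ _ => hb0 n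

end IsConvergentSeries

/-- The `ℂ`-subalgebra of convergent power series in `ℂ⟦z₁, …, z_d⟧`. -/
def convergentSubalgebra (d : ℕ) : Subalgebra ℂ (MvPowerSeries (Fin d) ℂ) where
  carrier := {f | IsConvergentSeries f}
  mul_mem' := fun hf hg => IsConvergentSeries.mul hf hg
  add_mem' := fun hf hg => IsConvergentSeries.add hf hg
  algebraMap_mem' := fun a => IsConvergentSeries.monomial 0 a

/-- The ring `ℂ{z₁, …, z_d}` of convergent power series. -/
abbrev ConvergentPowerSeries (d : ℕ) : Type := convergentSubalgebra d

namespace ConvergentPowerSeries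

/-- The `i`-th variable of `ℂ{z₁, …, z_d}`. -/
noncomputable def X {d : ℕ} (i : Fin d) : ConvergentPowerSeries d :=
  ⟨MvPowerSeries.X i, IsConvergentSeries.monomial (Finsupp.single i 1) 1⟩

theorem isUnit_of_constantCoeff_ne_zero {d : ℕ} (f : ConvergentPowerSeries d)
    (h : MvPowerSeries.constantCoeff f.1 ≠ 0) : IsUnit f := by
  have hu : f.1 * MvPowerSeries.invOfUnit f.1 (Units.mk0 _ h) = 1 :=
    MvPowerSeries.mul_invOfUnit _ _ rfl
  exact IsUnit.of_mul_eq_one ⟨_, IsConvergentSeries.of_mul_eq_one f.2 hu⟩ (Subtype.ext hu)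

instance (d : ℕ) : IsLocalRing (ConvergentPowerSeries d) :=
  IsLocalRing.of_isUnit_or_isUnit_one_sub_self fun f => by
    by_cases h : MvPowerSeries.constantCoeff f.1 = 0
    · right
      apply isUnit_of_constantCoeff_ne_zero
      simp [h]
    · exact Or.inl (isUnit_of_constantCoeff_ne_zero f h)

end ConvergentPowerSeries

section MixedMultiplicities

variable {A : Type*} [CommRing A] [IsLocalRing A] {s : ℕ}

open IsLocalRing

/-- The ideal `𝔪^u J₁^{v₁} ⋯ J_s^{v_s}`, where `w = (u, v₁, …, v_s)`. -/
noncomputable def mixedPower (J : Fin s → Ideal A) (w : Fin (s + 1) → ℕ) : Ideal A :=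
  maximalIdeal A ^ w 0 * ∏ j : Fin s, J j ^ w j.succ

/-- The Hilbert function of `R(𝔪 | J₁, …, J_s)`: the dimension over `A / 𝔪` of
`𝔪^u J₁^{v₁} ⋯ J_s^{v_s} / 𝔪^{u+1} J₁^{v₁} ⋯ J_s^{v_s}`. This quotient is `M / 𝔪 M`
for the ideal `M = 𝔪^u J₁^{v₁} ⋯ J_s^{v_s}`. -/
noncomputable def mixedHilbertFunction (J : Fin s → Ideal A) (w : Fin (s + 1) → ℕ) : ℕ :=
  Module.finrank (A ⧸ maximalIdeal A)
    (mixedPower J w ⧸ (maximalIdeal A • (⊤ : Submodule A (mixedPower J w))))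

/-- `P` is the Hilbert polynomial of `R(𝔪 | J₁, …, J_s)`: it agrees with the Hilbert function
whenever all of `u, v₁, …, v_s` are large. -/
def IsMixedHilbertPolynomial (J : Fin s → Ideal A) (P : MvPolynomial (Fin (s + 1)) ℚ) : Prop :=
  ∃ N : ℕ, ∀ w : Fin (s + 1) → ℕ, (∀ j, N ≤ w j) →
    MvPolynomial.eval (fun j => (w j : ℚ)) P = mixedHilbertFunction J w

theorem IsMixedHilbertPolynomial.unique {J : Fin s → Ideal A}
    {P Q : MvPolynomial (Fin (s + 1)) ℚ} (hP : IsMixedHilbertPolynomial J P)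
    (hQ : IsMixedHilbertPolynomial J Q) : P = Q := by
  obtain ⟨N, hN⟩ := hP
  obtain ⟨N', hN'⟩ := hQ
  refine MvPolynomial.funext_set (fun _ => (fun n : ℕ => (n : ℚ)) '' Set.Ici (max N N'))
    (fun _ => (Set.Ici_infinite _).image Nat.cast_injective.injOn) fun x hx => ?_
  choose w hw hwx using fun j => hx j (Set.mem_univ j)
  obtain rfl : (fun j => (w j : ℚ)) = x := funext hwx
  rw [hN w fun j => (le_max_left _ _).trans (hw j), hN' w fun j => (le_max_right _ _).trans (hw j)]

/-- The mixed multiplicity `e_𝐢(𝔪 | J₁, …, J_s)` exists and equals `e`: the Hilbert polynomial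
exists, its total degree is `|𝐢|`, and its coefficient at `u^{i₀} v₁^{i₁} ⋯ v_s^{i_s}` is
`e / (i₀! i₁! ⋯ i_s!)`. -/
def HasMixedMultiplicity (J : Fin s → Ideal A) (i : Fin (s + 1) → ℕ) (e : ℕ) : Prop :=
  ∃ P : MvPolynomial (Fin (s + 1)) ℚ, IsMixedHilbertPolynomial J P ∧
    P.totalDegree = ∑ j, i j ∧
    P.coeff (Finsupp.equivFunOnFinite.symm i) = (e : ℚ) / ((∏ j, (i j).factorial : ℕ) : ℚ)

theorem HasMixedMultiplicity.unique {J : Fin s → Ideal A} {i : Fin (s + 1) → ℕ} {e e' : ℕ}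
    (h : HasMixedMultiplicity J i e) (h' : HasMixedMultiplicity J i e') : e = e' := by
  obtain ⟨P, hP, -, he⟩ := h
  obtain ⟨Q, hQ, -, he'⟩ := h'
  rw [hP.unique hQ, he'] at he
  have h0 : ((∏ j, (i j).factorial : ℕ) : ℚ) ≠ 0 :=
    Nat.cast_ne_zero.mpr (Finset.prod_ne_zero_iff.mpr fun j _ => Nat.factorial_ne_zero _)
  exact_mod_cast ((div_left_inj' h0).mp he).symm

end MixedMultiplicities

/-- The Alexandrov–Fenchel-type inequality for mixed multiplicities, with `n = k + 2`: for every
(Noetherian) local ring `A` of dimension `n + 1 ≥ 3`, all ideals `J₁, J₂, J₃, …, J_n` of height `n`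
and `𝐢 = (0, 1, …, 1)`,
`e_𝐢(𝔪 | J₁, J₁, J₃, …, J_n) e_𝐢(𝔪 | J₂, J₂, J₃, …, J_n) ≤ e_𝐢(𝔪 | J₁, J₂, J₃, …, J_n)²`.
Here `K` is the family `J₃, …, J_n`. -/
def AlexandrovFenchelForMixedMultiplicities.{u} : Prop :=
  ∀ (k : ℕ) (A : Type u) [CommRing A] [IsLocalRing A] [IsNoetherianRing A],
    ringKrullDim A = ((k + 3 : ℕ) : WithBot ℕ∞) →
    ∀ (J₁ J₂ : Ideal A) (K : Fin k → Ideal A),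
      J₁.height = ((k + 2 : ℕ) : ℕ∞) → J₂.height = ((k + 2 : ℕ) : ℕ∞) →
      (∀ j, (K j).height = ((k + 2 : ℕ) : ℕ∞)) →
      ∀ e₁₁ e₁₂ e₂₂ : ℕ,
        HasMixedMultiplicity (Fin.cons J₁ (Fin.cons J₁ K) : Fin (k + 2) → Ideal A)
          (Fin.cons 0 fun _ => 1) e₁₁ →
        HasMixedMultiplicity (Fin.cons J₁ (Fin.cons J₂ K) : Fin (k + 2) → Ideal A)
          (Fin.cons 0 fun _ => 1) e₁₂ →
        HasMixedMultiplicity (Fin.cons J₂ (Fin.cons J₂ K) : Fin (k + 2) → Ideal A)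
          (Fin.cons 0 fun _ => 1) e₂₂ →
        e₁₁ * e₂₂ ≤ e₁₂ ^ 2

/-!
The ring `ℂ{z₁, …, z_d}` is Noetherian by division: fix a weight that separates the exponents, so
that every nonzero series has a leading monomial, of least weight. Division by finitely many series
is a small perturbation of division by their leading monomials, for the weighted `ℓ¹` norm on a
small polydisc, and Dickson's lemma bounds the number of leading monomials that are needed. The
dimension is `d` because `(z₁) < (z₁, z₂) < ⋯` is a chain of primes and the maximal ideal has `d`
generators.

The ideals `𝔪ᵘ J₁ᵃ J₂ᵇ` are monomial, so `𝔪ᵘ J₁ᵃ J₂ᵇ / 𝔪ᵘ⁺¹ J₁ᵃ J₂ᵇ` has a basis indexed by the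
monomials in the first ideal and outside the second. Fix the exponents of `x` and `z`. Membership in
`𝔪ᵘ J₁ᵃ J₂ᵇ` is then a lower bound on the exponent of `y` together with one on the degree, since one
generator of `J₁ᵃ J₂ᵇ` is optimal for both. Outside `𝔪ᵘ⁺¹ J₁ᵃ J₂ᵇ` the bound on the degree is an
equality, which determines the exponent of `y`. Counting the pairs of exponents of `x` and `z`
gives, for `u ≥ 1`, the dimension
`((u + 1)(u + 2) + 2(2a + 3b)(u + 1) + a² + 2ab + 2b² - a - 4b) / 2`.
The mixed multiplicities `1`, `1`, `2` are read off from the quadratic form `a² + 2ab + 2b²`, with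
`(a, b) = (v₁ + v₂, 0)`, `(v₁, v₂)`, `(0, v₁ + v₂)`. The inequality of Trung and Verma would require
this form to be indefinite or degenerate, but it is positive definite.
-/

open MvPowerSeries Filter
open scoped ENNReal Topology Pointwise

/-! ### Division of convergent power series -/

section GenericWeight

theorem exists_weight_injective (d : ℕ) :
    ∃ w : Fin d → ℝ, (∀ i, 0 < w i) ∧ Function.Injective (Finsupp.weight (R := ℕ) w) := by
  -- The weights `1, t, t², …` with `t` transcendental are linearly independent over `ℤ`.
  have ht := transcendental_liouvilleNumber le_rfl
  set t := liouvilleNumber (2 : ℕ)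
  have htpos : 0 < t := (tsum_nonneg fun k => by positivity).lt_of_ne' fun h : t = 0 =>
    ht (h ▸ isAlgebraic_zero)
  have hweight : ∀ n : Fin d →₀ ℕ, Finsupp.weight (fun i : Fin d => t ^ (i : ℕ)) n =
      Polynomial.aeval t (Polynomial.ofFn d fun i => (n i : ℤ)) := fun n => by
    simp [Finsupp.weight_eq_sum, Polynomial.ofFn_eq_sum_monomial]
  refine ⟨fun i => t ^ (i : ℕ), fun i => pow_pos htpos _, fun m n hmn => ?_⟩
  rw [hweight, hweight] at hmn
  have hcoe := Polynomial.injective_ofFn d (transcendental_iff_injective.mp ht hmn)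
  exact Finsupp.ext fun i => Nat.cast_injective (congrFun hcoe i)

variable {σ : Type*} {w : σ → ℝ}

theorem weight_nonneg (hw : ∀ i, 0 < w i) (n : σ →₀ ℕ) : 0 ≤ Finsupp.weight w n := by
  rw [Finsupp.weight_apply]
  exact Finsupp.sum_nonneg' fun i => nsmul_nonneg (hw i).le _

theorem finite_setOf_weight_le [Finite σ] (hw : ∀ i, 0 < w i) (c : ℝ) :
    {n : σ →₀ ℕ | Finsupp.weight w n ≤ c}.Finite := by
  classical
  have := Fintype.ofFinite σ
  refine (Set.finite_Iic (Finsupp.equivFunOnFinite.symm fun i => ⌊c / w i⌋₊)).subset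
    fun n (hn : _ ≤ c) i => Nat.le_floor ((le_div_iff₀ (hw i)).mpr (le_trans ?_ hn))
  simp only [Finsupp.weight_eq_sum, nsmul_eq_mul]
  exact Finset.single_le_sum (f := fun i => (n i : ℝ) * w i)
    (fun i _ => mul_nonneg (Nat.cast_nonneg _) (hw i).le) (Finset.mem_univ i)

theorem exists_weight_le_of_mem [Finite σ] (hw : ∀ i, 0 < w i) {S : Set (σ →₀ ℕ)}
    (hS : S.Nonempty) : ∃ m ∈ S, ∀ n ∈ S, Finsupp.weight w m ≤ Finsupp.weight w n := by
  obtain ⟨n₀, hn₀⟩ := hS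
  obtain ⟨m, ⟨hmS, hm₀⟩, hmin⟩ := Set.exists_min_image
    (S ∩ {n | Finsupp.weight w n ≤ Finsupp.weight w n₀}) (Finsupp.weight w)
    ((finite_setOf_weight_le hw _).inter_of_right S) ⟨n₀, hn₀, le_refl (Finsupp.weight w n₀)⟩
  refine ⟨m, hmS, fun n hn => ?_⟩
  rcases le_total (Finsupp.weight w n) (Finsupp.weight w n₀) with h | h
  · exact hmin n ⟨hn, h⟩
  · exact le_trans hm₀ h

end GenericWeight

section WeightedNorm

/-- The factor `exp (-s ⟨w, n⟩)`, the value of the monomial with exponent `n` at the point with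
coordinates `exp (-s wᵢ)`. Large `s` means a small polydisc. -/
noncomputable def expWeight {σ : Type*} (w : σ → ℝ) (s : ℝ) (n : σ →₀ ℕ) : ℝ≥0∞ :=
  ENNReal.ofReal (Real.exp (-s * Finsupp.weight w n))

/-- The weighted `ℓ¹` norm `∑ ‖fₙ‖ exp (-s ⟨w, n⟩)` on the polydisc with radii `exp (-s wᵢ)`. It is
`⊤` where the sum diverges. -/
noncomputable def weightedNorm {σ 𝕜 : Type*} [NormedField 𝕜] (w : σ → ℝ) (s : ℝ)
    (f : MvPowerSeries σ 𝕜) : ℝ≥0∞ :=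
  ∑' n, ‖coeff n f‖ₑ * expWeight w s n

variable {σ 𝕜 : Type*} [NormedField 𝕜] {w : σ → ℝ} {s : ℝ}

theorem expWeight_add (m n : σ →₀ ℕ) :
    expWeight w s (m + n) = expWeight w s m * expWeight w s n := by
  rw [expWeight, map_add, mul_add, Real.exp_add, ENNReal.ofReal_mul (Real.exp_nonneg _)]; rfl

theorem expWeight_ne_zero (n : σ →₀ ℕ) : expWeight w s n ≠ 0 := by
  simp [expWeight, Real.exp_pos]

theorem enorm_coeff_mul_expWeight_le (f : MvPowerSeries σ 𝕜) (n : σ →₀ ℕ) :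
    ‖coeff n f‖ₑ * expWeight w s n ≤ weightedNorm w s f :=
  ENNReal.le_tsum n

theorem weightedNorm_eq_zero {f : MvPowerSeries σ 𝕜} : weightedNorm w s f = 0 ↔ f = 0 := by
  simp [weightedNorm, expWeight_ne_zero, MvPowerSeries.ext_iff]

theorem weightedNorm_add_le (f g : MvPowerSeries σ 𝕜) :
    weightedNorm w s (f + g) ≤ weightedNorm w s f + weightedNorm w s g := by
  simp only [weightedNorm, ← ENNReal.tsum_add, ← add_mul, map_add]
  gcongr
  exact enorm_add_le _ _

theorem weightedNorm_sub_le (f g : MvPowerSeries σ 𝕜) :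
    weightedNorm w s (f - g) ≤ weightedNorm w s f + weightedNorm w s g := by
  simp only [weightedNorm, ← ENNReal.tsum_add, ← add_mul, map_sub]
  gcongr
  exact enorm_sub_le

theorem weightedNorm_sum_le {ι : Type*} (t : Finset ι) (f : ι → MvPowerSeries σ 𝕜) :
    weightedNorm w s (∑ i ∈ t, f i) ≤ ∑ i ∈ t, weightedNorm w s (f i) :=
  Finset.le_sum_of_subadditive _ (weightedNorm_eq_zero.mpr rfl).le weightedNorm_add_le _ _

theorem weightedNorm_mul_le (f g : MvPowerSeries σ 𝕜) :
    weightedNorm w s (f * g) ≤ weightedNorm w s f * weightedNorm w s g := by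
  classical
  let term (p : (σ →₀ ℕ) × (σ →₀ ℕ)) : ℝ≥0∞ :=
    (‖coeff p.1 f‖ₑ * expWeight w s p.1) * (‖coeff p.2 g‖ₑ * expWeight w s p.2)
  have hle : ∀ n, ‖coeff n (f * g)‖ₑ * expWeight w s n ≤
      ∑ p ∈ Finset.HasAntidiagonal.antidiagonal n, term p := fun n => by
    rw [coeff_mul]
    refine (mul_le_mul_left (enorm_sum_le _ _) _).trans_eq ?_
    rw [Finset.sum_mul]
    refine Finset.sum_congr rfl fun p hp => ?_
    rw [← Finset.HasAntidiagonal.mem_antidiagonal.mp hp, expWeight_add, enorm_mul,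
      mul_mul_mul_comm]
  calc weightedNorm w s (f * g)
      ≤ ∑' n, ∑ p ∈ Finset.HasAntidiagonal.antidiagonal n, term p := ENNReal.tsum_le_tsum hle
    _ = ∑' p, term p := by
        rw [← Finset.HasAntidiagonal.sigmaAntidiagonalEquivProd.tsum_eq, ENNReal.tsum_sigma']
        exact tsum_congr fun n => (Finset.tsum_subtype _ term).symm
    _ = weightedNorm w s f * weightedNorm w s g := by
        rw [weightedNorm, weightedNorm, ← ENNReal.tsum_mul_right, ENNReal.tsum_prod']
        simp only [term, ENNReal.tsum_mul_left]

theorem weightedNorm_anti (hw : ∀ i, 0 < w i) (f : MvPowerSeries σ 𝕜) :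
    Antitone fun s => weightedNorm w s f := by
  intro s t hst
  have := weight_nonneg hw
  simp only [weightedNorm, expWeight]
  gcongr
  exact this _

theorem exists_weightedNorm_sub_sum_le [CompleteSpace 𝕜] {F : ℕ → MvPowerSeries σ 𝕜}
    (hF : ∑' k, weightedNorm w s (F k) ≠ ⊤) :
    ∃ h, ∀ K, weightedNorm w s (h - ∑ k ∈ Finset.range K, F k) ≤
      ∑' k, weightedNorm w s (F (k + K)) := by
  have hsummable : ∀ n, Summable fun k => coeff n (F k) := fun n => by
    refine .of_enorm fun htop => hF (top_le_iff.mp ?_)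
    calc (⊤ : ℝ≥0∞) = (∑' k, ‖coeff n (F k)‖ₑ) * expWeight w s n := by
          rw [htop, ENNReal.top_mul (expWeight_ne_zero n)]
      _ ≤ ∑' k, weightedNorm w s (F k) := by
          rw [← ENNReal.tsum_mul_right]
          exact ENNReal.tsum_le_tsum fun k => enorm_coeff_mul_expWeight_le _ _
  let h : MvPowerSeries σ 𝕜 := fun n => ∑' k, coeff n (F k)
  refine ⟨h, fun K => ?_⟩
  have hcoeff : ∀ n, coeff n (h - ∑ k ∈ Finset.range K, F k) =
      ∑' k, coeff n (F (k + K)) := fun n => by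
    rw [map_sub, map_sum, sub_eq_iff_eq_add']
    exact ((hsummable n).sum_add_tsum_nat_add K).symm
  simp only [weightedNorm]
  rw [ENNReal.tsum_comm]
  refine ENNReal.tsum_le_tsum fun n => ?_
  rw [hcoeff, ENNReal.tsum_mul_right]
  gcongr
  exact enorm_tsum_le_tsum_enorm

section Contraction

variable {T : MvPowerSeries σ 𝕜 →+ MvPowerSeries σ 𝕜}

theorem weightedNorm_iterate_le (hT : ∀ h, weightedNorm w s (T h) ≤ 2⁻¹ * weightedNorm w s h)
    (f : MvPowerSeries σ 𝕜) (k : ℕ) :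
    weightedNorm w s (T^[k] f) ≤ 2⁻¹ ^ k * weightedNorm w s f := by
  induction k with
  | zero => simp
  | succ k ih =>
    rw [Function.iterate_succ_apply', pow_succ', mul_assoc]
    exact (hT _).trans (by gcongr)

theorem weightedNorm_sub_map_sub_le
    (hT : ∀ h, weightedNorm w s (T h) ≤ 2⁻¹ * weightedNorm w s h) (f h : MvPowerSeries σ 𝕜)
    (K : ℕ) : weightedNorm w s (h - T h - f) ≤
      (1 + 2⁻¹) * weightedNorm w s (h - ∑ k ∈ Finset.range K, T^[k] f) +
        2⁻¹ ^ K * weightedNorm w s f := by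
  set P := ∑ k ∈ Finset.range K, T^[k] f with hP
  have hTP : P - T P = f - T^[K] f := by
    simp only [hP, map_sum, ← Finset.sum_sub_distrib, ← Function.iterate_succ_apply']
    exact Finset.sum_range_sub' (fun k => T^[k] f) K
  have hsplit : h - T h - f = (h - P) - T (h - P) - T^[K] f := by
    rw [map_sub, ← sub_eq_zero, ← sub_eq_zero.mpr hTP]
    abel
  calc weightedNorm w s (h - T h - f)
      ≤ weightedNorm w s (h - P) + weightedNorm w s (T (h - P)) + weightedNorm w s (T^[K] f) := by
        rw [hsplit]
        exact (weightedNorm_sub_le _ _).trans (by gcongr; exact weightedNorm_sub_le _ _)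
    _ ≤ weightedNorm w s (h - P) + 2⁻¹ * weightedNorm w s (h - P) +
          2⁻¹ ^ K * weightedNorm w s f := by
        gcongr
        exacts [hT _, weightedNorm_iterate_le hT f K]
    _ = _ := by rw [add_mul, one_mul]

theorem exists_sub_map_eq_of_weightedNorm_map_le [CompleteSpace 𝕜]
    (hT : ∀ h, weightedNorm w s (T h) ≤ 2⁻¹ * weightedNorm w s h) {f : MvPowerSeries σ 𝕜}
    (hf : weightedNorm w s f ≠ ⊤) : ∃ h, weightedNorm w s h ≠ ⊤ ∧ h - T h = f := by
  have hsum : ∑' k, weightedNorm w s (T^[k] f) ≠ ⊤ := by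
    refine ne_top_of_le_ne_top ?_ (ENNReal.tsum_le_tsum (weightedNorm_iterate_le hT f))
    rw [ENNReal.tsum_mul_right, ENNReal.tsum_geometric, ENNReal.one_sub_inv_two, inv_inv]
    exact ENNReal.mul_ne_top ENNReal.ofNat_ne_top hf
  obtain ⟨h, hh⟩ := exists_weightedNorm_sub_sum_le hsum
  refine ⟨h, ne_top_of_le_ne_top hsum (by simpa using hh 0), ?_⟩
  have hbound (K : ℕ) : weightedNorm w s (h - T h - f) ≤
      (1 + 2⁻¹) * (∑' k, weightedNorm w s (T^[k + K] f)) + 2⁻¹ ^ K * weightedNorm w s f :=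
    (weightedNorm_sub_map_sub_le hT f h K).trans (by gcongr; exact hh K)
  have hlim : Tendsto (fun K => (1 + 2⁻¹) * (∑' k, weightedNorm w s (T^[k + K] f)) +
      2⁻¹ ^ K * weightedNorm w s f) atTop (𝓝 ((1 + 2⁻¹) * 0 + 0 * weightedNorm w s f)) :=
    (ENNReal.Tendsto.const_mul (ENNReal.tendsto_sum_nat_add _ hsum) (.inr (by simp))).add
      (ENNReal.Tendsto.mul_const
        (ENNReal.tendsto_pow_atTop_nhds_zero_of_lt_one (by simp)) (.inr hf))
  rw [mul_zero, zero_mul, add_zero] at hlim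
  rw [← sub_eq_zero, ← weightedNorm_eq_zero (w := w) (s := s)]
  exact le_antisymm (ge_of_tendsto' hlim hbound) zero_le

end Contraction

end WeightedNorm

section Convergence

variable {d : ℕ} {w : Fin d → ℝ} {s : ℝ}

theorem IsConvergentSeries.exists_weightedNorm_ne_top (hw : ∀ i, 0 < w i)
    {f : MvPowerSeries (Fin d) ℂ} (hf : IsConvergentSeries f) :
    ∃ s, weightedNorm w s f ≠ ⊤ := by
  obtain ⟨ρ, hρ, hf⟩ := hf
  obtain ⟨s, hs⟩ : ∃ s : ℝ, ∀ i, -s * w i ≤ Real.log ρ := by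
    have h : ∀ i, ∀ᶠ s : ℝ in atTop, -s * w i ≤ Real.log ρ := fun i => by
      filter_upwards [eventually_ge_atTop (-Real.log ρ / w i)] with s hs
      rw [div_le_iff₀ (hw i)] at hs
      linarith
    exact (eventually_all.mpr h).exists
  refine ⟨s, ne_top_of_le_ne_top hf.tsum_ofReal_ne_top (ENNReal.tsum_le_tsum fun n => ?_)⟩
  have hexp : Real.exp (-s * Finsupp.weight w n) ≤ ρ ^ n.degree := by
    rw [← Real.exp_log (pow_pos hρ _), Real.log_pow, Real.exp_le_exp, Finsupp.weight_eq_sum,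
      Finset.mul_sum, Finsupp.degree_eq_sum, Nat.cast_sum, Finset.sum_mul]
    refine Finset.sum_le_sum fun i _ => ?_
    rw [nsmul_eq_mul, mul_left_comm]
    gcongr
    exact hs i
  rw [ENNReal.ofReal_mul (norm_nonneg _), ofReal_norm, expWeight]
  gcongr

theorem IsConvergentSeries.of_weightedNorm_ne_top (hw : ∀ i, 0 < w i)
    {f : MvPowerSeries (Fin d) ℂ} (hf : weightedNorm w s f ≠ ⊤) : IsConvergentSeries f := by
  have hfmax := ne_top_of_le_ne_top hf (weightedNorm_anti hw f (le_max_left s 0))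
  set t := max s 0
  have ht : 0 ≤ t := le_max_right _ _
  have hexp : ∀ n : Fin d →₀ ℕ,
      Real.exp (-t * ∑ i, w i) ^ n.degree ≤ Real.exp (-t * Finsupp.weight w n) := fun n => by
    rw [← Real.exp_nat_mul, Real.exp_le_exp, mul_left_comm, neg_mul, neg_mul, neg_le_neg_iff,
      Finsupp.weight_eq_sum]
    refine mul_le_mul_of_nonneg_left ?_ ht
    rw [Finset.mul_sum]
    refine Finset.sum_le_sum fun i _ => ?_
    rw [nsmul_eq_mul]
    have := (hw i).le
    gcongr
    exact Finsupp.le_degree i n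
  refine ⟨Real.exp (-t * ∑ i, w i), Real.exp_pos _, Summable.of_nonneg_of_le
    (fun n => by positivity) (fun n => ?_) (ENNReal.summable_toReal hfmax)⟩
  rw [ENNReal.toReal_mul, toReal_enorm, expWeight, ENNReal.toReal_ofReal (Real.exp_nonneg _)]
  gcongr
  exact hexp n

end Convergence

section LeadingTerm

/-- The power series `g` is the monomial with exponent `α` and coefficient `1` plus terms of larger
weight. This is the notion of a normalised leading term in a division algorithm. -/
def HasMonicLeadingTerm {σ R : Type*} [Ring R] (w : σ → ℝ) (α : σ →₀ ℕ)
    (g : MvPowerSeries σ R) : Prop :=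
  ∀ n, coeff n (g - monomial α 1) ≠ 0 → Finsupp.weight w α < Finsupp.weight w n

theorem exists_hasMonicLeadingTerm_smul {σ 𝕜 : Type*} [Finite σ] [Field 𝕜] {w : σ → ℝ}
    (hw : ∀ i, 0 < w i) (hinj : Function.Injective (Finsupp.weight (R := ℕ) w))
    {f : MvPowerSeries σ 𝕜} (hf : f ≠ 0) :
    ∃ α, ∃ c : 𝕜, coeff α f ≠ 0 ∧ HasMonicLeadingTerm w α (c • f) := by
  classical
  have hne : {n | coeff n f ≠ 0}.Nonempty := by
    by_contra! hempty
    exact hf (MvPowerSeries.ext fun n => not_not.mp (hempty.le · : ¬ coeff n f ≠ 0))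
  obtain ⟨α, hα, hmin⟩ := exists_weight_le_of_mem hw hne
  refine ⟨α, (coeff α f)⁻¹, hα, fun n hn => ?_⟩
  have hnα : n ≠ α := by
    rintro rfl
    exact hn (by simp [inv_mul_cancel₀ hα])
  rw [map_sub, coeff_monomial_ne hnα, sub_zero, map_smul, smul_eq_mul] at hn
  exact (hmin n (right_ne_zero_of_mul hn)).lt_of_ne fun h => hnα (hinj h).symm

theorem exists_weight_gap {σ R : Type*} [Finite σ] [Semiring R] {w : σ → ℝ} (hw : ∀ i, 0 < w i)
    {h : MvPowerSeries σ R} {c : ℝ} (hc : ∀ n, coeff n h ≠ 0 → c < Finsupp.weight w n) :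
    ∃ δ > 0, ∀ n, coeff n h ≠ 0 → c + δ ≤ Finsupp.weight w n := by
  rcases {n | coeff n h ≠ 0}.eq_empty_or_nonempty with hempty | hne
  · exact ⟨1, one_pos, fun n hn => (hempty.subset hn).elim⟩
  · obtain ⟨m, hm, hmin⟩ := exists_weight_le_of_mem hw hne
    exact ⟨Finsupp.weight w m - c, sub_pos.mpr (hc m hm),
      fun n hn => by linarith [hmin n hn]⟩

variable {d : ℕ} {w : Fin d → ℝ}

theorem IsConvergentSeries.eventually_weightedNorm_le (hw : ∀ i, 0 < w i)
    {h : MvPowerSeries (Fin d) ℂ} (hconv : IsConvergentSeries h) {c ε : ℝ}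
    (hc : ∀ n, coeff n h ≠ 0 → c < Finsupp.weight w n) (hε : 0 < ε) :
    ∀ᶠ s in atTop, weightedNorm w s h ≤ ENNReal.ofReal (ε * Real.exp (-s * c)) := by
  obtain ⟨s₀, hs₀⟩ := hconv.exists_weightedNorm_ne_top hw
  obtain ⟨δ, hδ, hgap⟩ := exists_weight_gap hw hc
  set C := (weightedNorm w s₀ h).toReal * Real.exp (s₀ * (c + δ)) with hC
  have hlim : Tendsto (fun s : ℝ => C * Real.exp (-(s * δ))) atTop (𝓝 (C * 0)) :=
    (Real.tendsto_exp_neg_atTop_nhds_zero.comp (tendsto_id.atTop_mul_const hδ)).const_mul C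
  rw [mul_zero] at hlim
  filter_upwards [hlim.eventually_le_const hε, eventually_ge_atTop s₀] with s hs hss
  have hterm : ∀ n, ‖coeff n h‖ₑ * expWeight w s n ≤
      ENNReal.ofReal (Real.exp (-(s - s₀) * (c + δ))) * (‖coeff n h‖ₑ * expWeight w s₀ n) := by
    intro n
    by_cases hn : coeff n h = 0
    · simp [hn]
    rw [mul_left_comm, expWeight, expWeight, ← ENNReal.ofReal_mul (Real.exp_nonneg _),
      ← Real.exp_add]
    gcongr
    nlinarith [mul_le_mul_of_nonneg_left (hgap n hn) (sub_nonneg.mpr hss)]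
  calc weightedNorm w s h
      ≤ ENNReal.ofReal (Real.exp (-(s - s₀) * (c + δ))) * weightedNorm w s₀ h := by
        rw [weightedNorm, weightedNorm, ← ENNReal.tsum_mul_left]
        exact ENNReal.tsum_le_tsum hterm
    _ = ENNReal.ofReal (C * Real.exp (-(s * δ)) * Real.exp (-s * c)) := by
        rw [← ENNReal.ofReal_toReal hs₀, ← ENNReal.ofReal_mul (Real.exp_nonneg _), hC, mul_assoc,
          mul_assoc, ← Real.exp_add, ← Real.exp_add, mul_comm]
        ring_nf
    _ ≤ ENNReal.ofReal (ε * Real.exp (-s * c)) := by gcongr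

end LeadingTerm

section ShiftPart

/-- The part of `h` supported on the exponents in `P`, divided by the monomial with exponent `α`.
The exponents in `P` that are not `≥ α` are dropped. -/
noncomputable def shiftPart {σ R : Type*} [Semiring R] (P : Set (σ →₀ ℕ)) (α : σ →₀ ℕ) :
    MvPowerSeries σ R →ₗ[R] MvPowerSeries σ R where
  toFun h m := P.indicator (fun n => coeff n h) (m + α)
  map_add' f g :=
    funext fun m => congrFun (Set.indicator_add P (coeff · f) (coeff · g)) (m + α)
  map_smul' c f :=
    funext fun m => congrFun (Set.indicator_const_smul P c (coeff · f)) (m + α)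

variable {σ R : Type*} [Semiring R]

theorem coeff_shiftPart (P : Set (σ →₀ ℕ)) (α m : σ →₀ ℕ) (h : MvPowerSeries σ R) :
    coeff m (shiftPart P α h) = P.indicator (fun n => coeff n h) (m + α) := rfl

theorem coeff_monomial_mul_shiftPart {P : Set (σ →₀ ℕ)} {α : σ →₀ ℕ} (hP : ∀ n ∈ P, α ≤ n)
    (h : MvPowerSeries σ R) (n : σ →₀ ℕ) :
    coeff n (monomial α 1 * shiftPart P α h) = P.indicator (fun n => coeff n h) n := by
  classical
  rw [coeff_monomial_mul, one_mul, coeff_shiftPart]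
  split_ifs with hn
  · rw [tsub_add_cancel_of_le hn]
  · rw [Set.indicator_of_notMem fun hmem => hn (hP n hmem)]

theorem expWeight_mul_weightedNorm_shiftPart_le {𝕜 : Type*} [NormedField 𝕜] {w : σ → ℝ} {s : ℝ}
    (P : Set (σ →₀ ℕ)) (α : σ →₀ ℕ) (h : MvPowerSeries σ 𝕜) :
    expWeight w s α * weightedNorm w s (shiftPart P α h) ≤
      ∑' n, P.indicator (fun n => ‖coeff n h‖ₑ * expWeight w s n) n := by
  rw [weightedNorm, ← ENNReal.tsum_mul_left]
  refine le_trans (ENNReal.tsum_le_tsum fun m => ?_)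
    (ENNReal.tsum_comp_le_tsum_of_injective (add_left_injective α) _)
  rw [coeff_shiftPart]
  by_cases hm : m + α ∈ P
  · simp only [Set.indicator_of_mem hm, expWeight_add]
    exact le_of_eq (by ring)
  · simp [hm]

theorem IsConvergentSeries.map_shiftPart {d : ℕ} {h : MvPowerSeries (Fin d) ℂ}
    (hh : IsConvergentSeries h) (P : Set (Fin d →₀ ℕ)) (α : Fin d →₀ ℕ) :
    IsConvergentSeries (shiftPart P α h) := by
  have hw : ∀ i : Fin d, (0 : ℝ) < (fun _ => 1) i := fun _ => one_pos
  obtain ⟨s, hs⟩ := hh.exists_weightedNorm_ne_top hw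
  refine .of_weightedNorm_ne_top (s := s) hw fun htop => hs (top_le_iff.mp ?_)
  calc ⊤ = expWeight _ s α * weightedNorm _ s (shiftPart P α h) := by
        rw [htop, ENNReal.mul_top (expWeight_ne_zero _)]
    _ ≤ _ := expWeight_mul_weightedNorm_shiftPart_le P α h
    _ ≤ weightedNorm _ s h := ENNReal.tsum_le_tsum fun n => Set.indicator_le_self _ _ n

/-- An index `i` with `α i ≤ n`, chosen once and for all, or `none` if there is none. -/
noncomputable def chooseDivisor {ι : Type*} (α : ι → σ →₀ ℕ) (n : σ →₀ ℕ) : Option ι :=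
  open Classical in if h : ∃ i, α i ≤ n then some h.choose else none

theorem le_of_chooseDivisor_eq_some {ι : Type*} {α : ι → σ →₀ ℕ} {n : σ →₀ ℕ} {i : ι}
    (h : chooseDivisor α n = some i) : α i ≤ n := by
  unfold chooseDivisor at h
  split_ifs at h with hex
  exact Option.some_injective _ h ▸ hex.choose_spec

theorem not_le_of_chooseDivisor_eq_none {ι : Type*} {α : ι → σ →₀ ℕ} {n : σ →₀ ℕ}
    (h : chooseDivisor α n = none) (i : ι) : ¬ α i ≤ n := fun hi => by
  simp [chooseDivisor, show ∃ i, α i ≤ n from ⟨i, hi⟩] at h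

theorem sum_indicator_chooseDivisor_add {ι M : Type*} [Fintype ι] [AddCommMonoid M]
    (α : ι → σ →₀ ℕ) (f : (σ →₀ ℕ) → M) (n : σ →₀ ℕ) :
    ∑ i, {n | chooseDivisor α n = some i}.indicator f n +
      {n | chooseDivisor α n = none}.indicator f n = f n := by
  classical
  cases h : chooseDivisor α n <;> simp [Set.indicator_apply, h]

theorem sum_monomial_mul_shiftPart_add {ι : Type*} [Fintype ι] (α : ι → σ →₀ ℕ)
    (h : MvPowerSeries σ R) :
    ∑ i, monomial (α i) 1 * shiftPart {n | chooseDivisor α n = some i} (α i) h +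
      shiftPart {n | chooseDivisor α n = none} 0 h = h := by
  ext n
  have hle : ∀ i, ∀ n ∈ {n | chooseDivisor α n = some i}, α i ≤ n :=
    fun i n hn => le_of_chooseDivisor_eq_some hn
  simp only [map_add, map_sum, coeff_shiftPart, add_zero, coeff_monomial_mul_shiftPart (hle _)]
  exact sum_indicator_chooseDivisor_add α (fun n => coeff n h) n

end ShiftPart

section Division

variable {d : ℕ} {ι : Type*} [Fintype ι] {w : Fin d → ℝ} {s : ℝ}

/-- The error `∑ qᵢ tᵢ` made when `h = ∑ qᵢ z ^ αᵢ + r`, a division by monomials, is read as a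
division by the series `z ^ αᵢ - tᵢ`. -/
noncomputable def divisionError {σ R : Type*} [CommSemiring R] (α : ι → σ →₀ ℕ)
    (t : ι → MvPowerSeries σ R) : MvPowerSeries σ R →+ MvPowerSeries σ R where
  toFun h := ∑ i, t i * shiftPart {n | chooseDivisor α n = some i} (α i) h
  map_zero' := by simp
  map_add' f g := by simp [mul_add, Finset.sum_add_distrib]

theorem weightedNorm_divisionError_le {σ 𝕜 : Type*} [NormedField 𝕜] {w : σ → ℝ}
    {α : ι → σ →₀ ℕ} {t : ι → MvPowerSeries σ 𝕜} {ε : ℝ≥0∞}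
    (ht : ∀ i, weightedNorm w s (t i) ≤ ε * expWeight w s (α i)) (h : MvPowerSeries σ 𝕜) :
    weightedNorm w s (divisionError α t h) ≤ ε * weightedNorm w s h := by
  set P : ι → Set (σ →₀ ℕ) := fun i => {n | chooseDivisor α n = some i}
  set a : (σ →₀ ℕ) → ℝ≥0∞ := fun n => ‖coeff n h‖ₑ * expWeight w s n
  have hterm : ∀ i, weightedNorm w s (t i * shiftPart (P i) (α i) h) ≤
      ε * ∑' n, (P i).indicator a n := fun i =>
    calc weightedNorm w s (t i * shiftPart (P i) (α i) h)
        ≤ ε * expWeight w s (α i) * weightedNorm w s (shiftPart (P i) (α i) h) :=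
          (weightedNorm_mul_le _ _).trans (by gcongr; exact ht i)
      _ ≤ ε * ∑' n, (P i).indicator a n := by
          rw [mul_assoc]
          gcongr
          exact expWeight_mul_weightedNorm_shiftPart_le _ _ _
  calc weightedNorm w s (divisionError α t h)
      ≤ ∑ i, weightedNorm w s (t i * shiftPart (P i) (α i) h) := weightedNorm_sum_le _ _
    _ ≤ ∑ i, ε * ∑' n, (P i).indicator a n := Finset.sum_le_sum fun i _ => hterm i
    _ = ε * ∑' n, ∑ i, (P i).indicator a n := by
        rw [← Finset.mul_sum, Summable.tsum_finsetSum fun _ _ => ENNReal.summable]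
    _ ≤ ε * weightedNorm w s h := by
        gcongr
        exact ENNReal.tsum_le_tsum fun n =>
          le_self_add.trans_eq (sum_indicator_chooseDivisor_add α a n)

theorem ConvergentPowerSeries.exists_eq_sum_mul_add (hw : ∀ i, 0 < w i) {α : ι → Fin d →₀ ℕ}
    {g : ι → ConvergentPowerSeries d} (hg : ∀ i, HasMonicLeadingTerm w (α i) (g i).1)
    (f : ConvergentPowerSeries d) :
    ∃ (q : ι → ConvergentPowerSeries d) (r : ConvergentPowerSeries d),
      f = ∑ i, q i * g i + r ∧ ∀ n, coeff n r.1 ≠ 0 → ∀ i, ¬ α i ≤ n := by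
  set t : ι → MvPowerSeries (Fin d) ℂ := fun i => monomial (α i) 1 - (g i).1 with ht
  have htconv : ∀ i, IsConvergentSeries (t i) := fun i =>
    (convergentSubalgebra d).sub_mem (IsConvergentSeries.monomial (α i) 1) (g i).2
  have htail : ∀ i n, coeff n (t i) ≠ 0 → Finsupp.weight w (α i) < Finsupp.weight w n :=
    fun i n hn => hg i n (by rwa [← neg_sub, map_neg, neg_ne_zero])
  obtain ⟨s₀, hs₀⟩ := f.2.exists_weightedNorm_ne_top hw
  obtain ⟨s, hsmall, hs⟩ := ((eventually_all.mpr fun i =>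
    (htconv i).eventually_weightedNorm_le hw (htail i) (inv_pos.mpr (two_pos (α := ℝ)))).and
      (eventually_ge_atTop s₀)).exists
  have hcontr : ∀ h, weightedNorm w s (divisionError α t h) ≤ 2⁻¹ * weightedNorm w s h :=
    weightedNorm_divisionError_le fun i => (hsmall i).trans_eq <| by
      rw [ENNReal.ofReal_mul (by positivity), expWeight, ENNReal.ofReal_inv_of_pos two_pos,
        ENNReal.ofReal_ofNat]
  obtain ⟨h, hh, hhf⟩ := exists_sub_map_eq_of_weightedNorm_map_le hcontr
    (ne_top_of_le_ne_top hs₀ (weightedNorm_anti hw _ hs))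
  have hconv : IsConvergentSeries h := .of_weightedNorm_ne_top hw hh
  let q : ι → ConvergentPowerSeries d := fun i =>
    ⟨_, hconv.map_shiftPart {n | chooseDivisor α n = some i} (α i)⟩
  let r : ConvergentPowerSeries d := ⟨_, hconv.map_shiftPart {n | chooseDivisor α n = none} 0⟩
  have hexpand : h - divisionError α t h = ∑ i, (q i).1 * (g i).1 + r.1 := by
    nth_rewrite 1 [← sum_monomial_mul_shiftPart_add α h]
    simp only [divisionError, AddMonoidHom.coe_mk, ZeroHom.coe_mk, ht, sub_mul,
      Finset.sum_sub_distrib, q, r, mul_comm _ (g _).1]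
    abel
  refine ⟨q, r, Subtype.ext (by simp [← hhf, hexpand]), fun n hn => ?_⟩
  rw [coeff_shiftPart, add_zero] at hn
  exact not_le_of_chooseDivisor_eq_none
    (Set.mem_of_indicator_ne_zero (s := {n | chooseDivisor α n = none}) hn)

end Division

section Noetherian

theorem exists_finite_subset_forall_exists_le {α : Type*} [PartialOrder α]
    [WellQuasiOrderedLE α] (S : Set α) : ∃ G ⊆ S, G.Finite ∧ ∀ a ∈ S, ∃ m ∈ G, m ≤ a := by
  refine ⟨{m | Minimal (· ∈ S) m}, fun m hm => hm.1,
    WellQuasiOrderedLE.finite_of_isAntichain (setOfPred_minimal_antichain _), fun a ha => ?_⟩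
  obtain ⟨m, hm, hmin⟩ := exists_minimal_le_of_wellFoundedLT (· ∈ S) a ha
  exact ⟨m, hmin, hm⟩

namespace ConvergentPowerSeries

theorem span_range_eq_of_hasMonicLeadingTerm {d : ℕ} {ι : Type*} [Finite ι] {w : Fin d → ℝ}
    (hw : ∀ i, 0 < w i) (hinj : Function.Injective (Finsupp.weight (R := ℕ) w))
    {I : Ideal (ConvergentPowerSeries d)} {α : ι → Fin d →₀ ℕ} {g : ι → ConvergentPowerSeries d}
    (hgI : ∀ i, g i ∈ I) (hg : ∀ i, HasMonicLeadingTerm w (α i) (g i).1)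
    (hI : ∀ f ∈ I, ∀ n, HasMonicLeadingTerm w n f.1 → ∃ i, α i ≤ n) :
    Ideal.span (Set.range g) = I := by
  have := Fintype.ofFinite ι
  have hle : Ideal.span (Set.range g) ≤ I := Ideal.span_le.mpr (Set.range_subset_iff.mpr hgI)
  refine le_antisymm hle fun f hf => ?_
  obtain ⟨q, r, hfqr, hr⟩ := exists_eq_sum_mul_add hw hg f
  have hsum : ∑ i, q i * g i ∈ Ideal.span (Set.range g) :=
    Ideal.sum_mem _ fun i _ => Ideal.mul_mem_left _ _ (Ideal.subset_span ⟨i, rfl⟩)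
  have hrI : r ∈ I := by
    rw [eq_sub_of_add_eq' hfqr.symm]
    exact I.sub_mem hf (hle hsum)
  have hr0 : r = 0 := by
    by_contra hne
    obtain ⟨n, c, hn, hc⟩ := exists_hasMonicLeadingTerm_smul hw hinj
      (fun h => hne (Subtype.ext h) : r.1 ≠ 0)
    obtain ⟨i, hi⟩ := hI (c • r) (Submodule.smul_of_tower_mem I c hrI) n hc
    exact hr n hn i hi
  rw [hfqr, hr0, add_zero]
  exact hsum

instance isNoetherianRing (d : ℕ) : IsNoetherianRing (ConvergentPowerSeries d) := by
  obtain ⟨w, hw, hinj⟩ := exists_weight_injective d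
  refine ⟨fun (I : Ideal (ConvergentPowerSeries d)) => ?_⟩
  obtain ⟨G, hGI, hGfin, hG⟩ :=
    exists_finite_subset_forall_exists_le {n | ∃ f ∈ I, HasMonicLeadingTerm w n f.1}
  have := hGfin.to_subtype
  choose g hgI hg using fun α : G => hGI α.2
  rw [← span_range_eq_of_hasMonicLeadingTerm hw hinj hgI hg fun f hf n hn =>
    (hG n ⟨f, hf, hn⟩).elim fun m hm => ⟨⟨m, hm.1⟩, hm.2⟩]
  exact Submodule.fg_span (Set.finite_range g)

end ConvergentPowerSeries

end Noetherian

/-! ### Monomial ideals -/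

namespace ConvergentPowerSeries

variable {d : ℕ}

section MonomialIdeal

/-- The monomial `z ^ n` as a convergent power series. -/
noncomputable def mon (n : Fin d →₀ ℕ) : ConvergentPowerSeries d :=
  ⟨monomial n 1, IsConvergentSeries.monomial n 1⟩

theorem coeff_mon_ne_zero_iff {m n : Fin d →₀ ℕ} : coeff m (mon n).1 ≠ 0 ↔ m = n := by
  classical simp [mon, coeff_monomial]

theorem mon_zero : mon (0 : Fin d →₀ ℕ) = 1 := rfl

theorem mon_add (m n : Fin d →₀ ℕ) : mon (m + n) = mon m * mon n :=
  Subtype.ext (by simp [mon, monomial_mul_monomial])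

/-- The ideal generated by the monomials with exponents in `T`. -/
noncomputable def monomialIdeal (T : Set (Fin d →₀ ℕ)) : Ideal (ConvergentPowerSeries d) :=
  Ideal.span (mon '' T)

variable {T : Set (Fin d →₀ ℕ)}

theorem mon_mem_monomialIdeal_of_le {t n : Fin d →₀ ℕ} (ht : t ∈ T) (htn : t ≤ n) :
    mon n ∈ monomialIdeal T := by
  rw [← add_tsub_cancel_of_le htn, mon_add]
  exact Ideal.mul_mem_right _ _ (Ideal.subset_span ⟨t, ht, rfl⟩)

theorem exists_le_of_mem_monomialIdeal {f : ConvergentPowerSeries d} (hf : f ∈ monomialIdeal T)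
    {n : Fin d →₀ ℕ} (hn : coeff n f.1 ≠ 0) : ∃ t ∈ T, t ≤ n := by
  classical
  rw [monomialIdeal] at hf
  induction hf using Submodule.span_induction generalizing n with
  | mem x hx =>
    obtain ⟨t, ht, rfl⟩ := hx
    exact ⟨t, ht, (coeff_mon_ne_zero_iff.mp hn).ge⟩
  | zero => simp at hn
  | add x y _ _ hx hy =>
    by_cases h : coeff n x.1 = 0
    · exact hy fun h' => hn (by simp [h, h'])
    · exact hx h
  | smul a x _ hx =>
    rw [smul_eq_mul, MulMemClass.coe_mul, coeff_mul] at hn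
    obtain ⟨p, hp, hp0⟩ := Finset.exists_ne_zero_of_sum_ne_zero hn
    obtain ⟨t, ht, htp⟩ := hx (right_ne_zero_of_mul hp0)
    rw [← Finset.HasAntidiagonal.mem_antidiagonal.mp hp]
    exact ⟨t, ht, htp.trans le_add_self⟩

theorem mem_monomialIdeal_iff {f : ConvergentPowerSeries d} :
    f ∈ monomialIdeal T ↔ ∀ n, coeff n f.1 ≠ 0 → ∃ t ∈ T, t ≤ n := by
  refine ⟨fun hf _ => exists_le_of_mem_monomialIdeal hf, fun hf => ?_⟩
  obtain ⟨G, hGT, hGfin, hG⟩ := exists_finite_subset_forall_exists_le T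
  have := hGfin.fintype
  let α : G → Fin d →₀ ℕ := Subtype.val
  have hrem : shiftPart {n | chooseDivisor α n = none} 0 f.1 = 0 := by
    ext n
    rw [coeff_shiftPart, add_zero, coeff_zero, Set.indicator_apply_eq_zero]
    intro hn
    by_contra h0
    obtain ⟨t, ht, htn⟩ := hf n h0
    obtain ⟨m, hm, hmt⟩ := hG t ht
    exact not_le_of_chooseDivisor_eq_none hn ⟨m, hm⟩ (hmt.trans htn)
  have hsum : f = ∑ i, mon (α i) *
      ⟨_, f.2.map_shiftPart {n | chooseDivisor α n = some i} (α i)⟩ := by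
    refine Subtype.ext ?_
    nth_rewrite 1 [← sum_monomial_mul_shiftPart_add α f.1]
    simp [hrem, mon]
  rw [hsum]
  exact Ideal.sum_mem _ fun i _ =>
    Ideal.mul_mem_right _ _ (mon_mem_monomialIdeal_of_le (hGT i.2) le_rfl)

theorem mon_mem_monomialIdeal_iff {n : Fin d →₀ ℕ} :
    mon n ∈ monomialIdeal T ↔ ∃ t ∈ T, t ≤ n := by
  simp only [mem_monomialIdeal_iff, coeff_mon_ne_zero_iff, forall_eq]

theorem monomialIdeal_zero : monomialIdeal (0 : Set (Fin d →₀ ℕ)) = 1 := by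
  rw [monomialIdeal, Set.image_zero, mon_zero, Ideal.span_singleton_one, Ideal.one_eq_top]

theorem monomialIdeal_add (T T' : Set (Fin d →₀ ℕ)) :
    monomialIdeal (T + T') = monomialIdeal T * monomialIdeal T' := by
  simp only [monomialIdeal, Ideal.span_mul_span', ← Set.image2_add, ← Set.image2_mul,
    Set.image_image2, Set.image2_image_left, Set.image2_image_right, mon_add]

theorem monomialIdeal_nsmul (k : ℕ) (T : Set (Fin d →₀ ℕ)) :
    monomialIdeal (k • T) = monomialIdeal T ^ k := by
  induction k with
  | zero => rw [zero_nsmul, pow_zero, monomialIdeal_zero]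
  | succ k ih => rw [succ_nsmul, monomialIdeal_add, ih, pow_succ]

theorem monomialIdeal_sum {ι : Type*} (s : Finset ι) (T : ι → Set (Fin d →₀ ℕ)) :
    monomialIdeal (∑ i ∈ s, T i) = ∏ i ∈ s, monomialIdeal (T i) := by
  classical
  induction s using Finset.induction_on with
  | empty => rw [Finset.sum_empty, Finset.prod_empty, monomialIdeal_zero]
  | insert i s hi ih => rw [Finset.sum_insert hi, Finset.prod_insert hi, monomialIdeal_add, ih]

end MonomialIdeal

section VariableIdeal

theorem X_eq_mon (i : Fin d) : X i = mon (Finsupp.single i 1) := rfl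

theorem mon_single (i : Fin d) (k : ℕ) : mon (Finsupp.single i k) = X i ^ k := by
  induction k with
  | zero => simp [mon_zero]
  | succ k ih => rw [Finsupp.single_add, mon_add, ih, pow_succ, X_eq_mon]

theorem mon_eq_prod (n : Fin d →₀ ℕ) : mon n = ∏ i, X i ^ n i := by
  induction n using Finsupp.induction_linear with
  | zero => simp [mon_zero]
  | add m n hm hn => simp [mon_add, hm, hn, pow_add, Finset.prod_mul_distrib]
  | single i k =>
    rw [mon_single, Finset.prod_eq_single i (fun j _ hj => by simp [hj.symm]) (by simp)]
    simp

/-- The exponents of the variables with index in `S`. -/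
def variableExponents (S : Set (Fin d)) : Set (Fin d →₀ ℕ) :=
  (fun i => Finsupp.single i 1) '' S

theorem mem_monomialIdeal_variableExponents_iff {S : Set (Fin d)} {f : ConvergentPowerSeries d} :
    f ∈ monomialIdeal (variableExponents S) ↔ ∀ n, coeff n f.1 ≠ 0 → ∃ i ∈ S, n i ≠ 0 := by
  simp [mem_monomialIdeal_iff, variableExponents, Nat.one_le_iff_ne_zero]

theorem X_mem_monomialIdeal_variableExponents_iff {S : Set (Fin d)} {i : Fin d} :
    X i ∈ monomialIdeal (variableExponents S) ↔ i ∈ S := by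
  simp [X_eq_mon, mem_monomialIdeal_variableExponents_iff, coeff_mon_ne_zero_iff,
    Finsupp.single_apply]

theorem monomialIdeal_variableExponents_le_iff {S : Set (Fin d)}
    {I : Ideal (ConvergentPowerSeries d)} :
    monomialIdeal (variableExponents S) ≤ I ↔ ∀ i ∈ S, X i ∈ I := by
  rw [monomialIdeal, variableExponents, Ideal.span_le, ← Set.image_comp, Set.image_subset_iff]
  rfl

theorem mem_maximalIdeal_iff {f : ConvergentPowerSeries d} :
    f ∈ IsLocalRing.maximalIdeal (ConvergentPowerSeries d) ↔ constantCoeff f.1 = 0 := by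
  rw [IsLocalRing.mem_maximalIdeal, mem_nonunits_iff, not_iff_comm]
  refine ⟨isUnit_of_constantCoeff_ne_zero f, fun hf => ?_⟩
  exact ((hf.map (convergentSubalgebra d).val).map (constantCoeff (σ := Fin d) (R := ℂ))).ne_zero

theorem maximalIdeal_eq_monomialIdeal :
    IsLocalRing.maximalIdeal (ConvergentPowerSeries d) =
      monomialIdeal (variableExponents Set.univ) := by
  ext f
  rw [mem_maximalIdeal_iff, mem_monomialIdeal_variableExponents_iff,
    ← coeff_zero_eq_constantCoeff_apply]
  refine ⟨fun h n hn => ?_, fun h => ?_⟩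
  · by_contra! hz
    obtain rfl : n = 0 := Finsupp.ext fun i => hz i (Set.mem_univ i)
    exact hn h
  · by_contra h0
    obtain ⟨i, -, hi⟩ := h 0 h0
    exact hi rfl

-- The ideal is the kernel of the homomorphism that sets the variables with index in `S` to zero.
theorem isPrime_monomialIdeal_variableExponents (S : Set (Fin d)) :
    (monomialIdeal (variableExponents S)).IsPrime := by
  classical
  let e := Function.Embedding.subtype (· ∈ Sᶜ)
  let ψ := (killCompl (R := ℂ) e).comp (convergentSubalgebra d).val
  have hker : monomialIdeal (variableExponents S) = RingHom.ker ψ := by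
    ext f
    rw [mem_monomialIdeal_variableExponents_iff, RingHom.mem_ker, MvPowerSeries.ext_iff]
    have hψ (n) : coeff n (ψ f) = coeff (Finsupp.embDomain e n) f.1 := coeff_killCompl f.1 n
    simp only [hψ, coeff_zero]
    refine ⟨fun h n => ?_, fun h n hn => ?_⟩
    · by_contra hn
      obtain ⟨i, hiS, hi⟩ := h _ hn
      exact hi (Finsupp.embDomain_of_notMem_range _ _ _ (by simpa [e] using hiS))
    · by_contra! hS
      have hsupp : (n.support : Set (Fin d)) ⊆ Set.range e := fun i hi => by
        simpa [e] using fun hiS => Finsupp.mem_support_iff.mp hi (hS i hiS)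
      refine hn ?_
      rw [← h (n.comapDomain e e.injective.injOn), Finsupp.embDomain_comapDomain hsupp]
  have : IsDomain (MvPowerSeries (↥Sᶜ) ℂ) := NoZeroDivisors.to_isDomain _
  rw [hker]
  exact RingHom.ker_isPrime ψ

theorem height_monomialIdeal_variableExponents (S : Finset (Fin d)) :
    (monomialIdeal (variableExponents (S : Set (Fin d)))).height = S.card := by
  classical
  have hprime (S : Set (Fin d)) := isPrime_monomialIdeal_variableExponents S
  apply le_antisymm
  · have hfin : (variableExponents (S : Set (Fin d))).Finite := S.finite_toSet.image _
    refine (Ideal.height_le_spanFinrank _ (hprime _).ne_top).trans (Nat.cast_le.mpr ?_)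
    calc _ ≤ (mon '' variableExponents (S : Set (Fin d))).ncard :=
          Submodule.spanFinrank_span_le_ncard_of_finite (hfin.image _)
      _ ≤ (variableExponents (S : Set (Fin d))).ncard := Set.ncard_image_le hfin
      _ ≤ S.card := (Set.ncard_image_le S.finite_toSet).trans_eq (Set.ncard_coe_finset S)
  · induction S using Finset.induction_on with
    | empty => simp
    | insert i S hi ih =>
      rw [Finset.card_insert_of_notMem hi, Nat.cast_add, Nat.cast_one]
      refine (add_le_add_left ih 1).trans
        (Ideal.height_add_one_le_of_lt_of_isPrime (lt_of_le_of_ne ?_ fun h => hi ?_))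
      · exact monomialIdeal_variableExponents_le_iff.mpr fun j hj =>
          X_mem_monomialIdeal_variableExponents_iff.mpr (by simp_all)
      · rw [← Finset.mem_coe, ← X_mem_monomialIdeal_variableExponents_iff, h]
        exact X_mem_monomialIdeal_variableExponents_iff.mpr (by simp)

theorem card_le_height_of_X_mem {I : Ideal (ConvergentPowerSeries d)} (S : Finset (Fin d))
    (hI : ∀ i ∈ S, X i ∈ I) : (S.card : ℕ∞) ≤ I.height := by
  rw [← height_monomialIdeal_variableExponents]
  exact Ideal.height_mono (monomialIdeal_variableExponents_le_iff.mpr (by simpa using hI))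

theorem ringKrullDim_eq (d : ℕ) : ringKrullDim (ConvergentPowerSeries d) = d := by
  rw [← IsLocalRing.maximalIdeal_height_eq_ringKrullDim, maximalIdeal_eq_monomialIdeal,
    ← Finset.coe_univ, height_monomialIdeal_variableExponents, Finset.card_fin]
  rfl

end VariableIdeal

end ConvergentPowerSeries

section MinimalGenerators

theorem finrank_quotient_smul_top_eq {A k M V : Type*} [CommRing A] [CommRing k]
    [AddCommGroup M] [Module A M] [AddCommGroup V] [Module k V] {I : Ideal A} {ε : A →+* k}
    (hε : Function.Surjective ε) (hI : RingHom.ker ε = I) (φ : M →ₛₗ[ε] V)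
    (hφ : Function.Surjective φ) (hker : LinearMap.ker φ = I • ⊤) :
    Module.finrank (A ⧸ I) (M ⧸ (I • ⊤ : Submodule A M)) = Module.finrank k V := by
  let i : A ⧸ I ≃+* k :=
    (Ideal.quotEquivOfEq hI.symm).trans (RingHom.quotientKerEquivOfSurjective hε)
  let j : (M ⧸ (I • ⊤ : Submodule A M)) ≃+ V := .ofBijective
    ((I • ⊤ : Submodule A M).liftQ φ hker.ge).toAddMonoidHom
    ⟨LinearMap.ker_eq_bot.mp (Submodule.ker_liftQ_eq_bot _ _ _ hker.le), fun v =>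
      (hφ v).imp' (Submodule.Quotient.mk) fun _ h => h⟩
  have hsmul (r : A ⧸ I) (m : M ⧸ (I • ⊤ : Submodule A M)) : j (r • m) = i r • j m := by
    obtain ⟨a, rfl⟩ := Ideal.Quotient.mk_surjective r
    obtain ⟨f, rfl⟩ := Submodule.Quotient.mk_surjective _ m
    exact φ.map_smulₛₗ a f
  rw [Module.finrank, ← Cardinal.toNat_lift, lift_rank_eq_of_equiv_equiv i j i.bijective hsmul,
    Cardinal.toNat_lift, Module.finrank]

theorem maximalIdeal_mul_mixedPower {A : Type*} [CommRing A] [IsLocalRing A] {s : ℕ}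
    (J : Fin s → Ideal A) (w : Fin (s + 1) → ℕ) :
    IsLocalRing.maximalIdeal A * mixedPower J w = mixedPower J (w + Pi.single 0 1) := by
  simp [mixedPower, pow_succ', mul_assoc]

end MinimalGenerators

namespace ConvergentPowerSeries

variable {d : ℕ}

open IsLocalRing

section MonomialHilbertFunction

/-- `ε : ℂ{z} → ℂ`, evaluation at the origin. -/
noncomputable def evalZero (d : ℕ) : ConvergentPowerSeries d →+* ℂ :=
  (constantCoeff (σ := Fin d) (R := ℂ)).comp (convergentSubalgebra d).val.toRingHom

theorem evalZero_surjective : Function.Surjective (evalZero d) :=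
  fun c => ⟨algebraMap ℂ _ c, constantCoeff_C (σ := Fin d) c⟩

theorem ker_evalZero : RingHom.ker (evalZero d) = maximalIdeal (ConvergentPowerSeries d) :=
  Ideal.ext fun _ => mem_maximalIdeal_iff.symm

theorem coeff_mul_of_minimal {n : Fin d →₀ ℕ} {f : ConvergentPowerSeries d}
    (hf : ∀ m < n, coeff m f.1 = 0) (a : ConvergentPowerSeries d) :
    coeff n (a * f).1 = evalZero d a * coeff n f.1 := by
  classical
  rw [MulMemClass.coe_mul, coeff_mul, Finset.sum_eq_single (0, n)]
  · rfl
  · rintro ⟨l, m⟩ hlm hne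
    rw [Finset.HasAntidiagonal.mem_antidiagonal] at hlm
    rw [hf m, mul_zero]
    refine lt_of_le_of_ne (hlm ▸ le_add_self) fun hmn => hne ?_
    rw [Prod.mk.injEq]
    exact ⟨by simpa [hmn] using hlm, hmn⟩
  · simp

variable {T : Set (Fin d →₀ ℕ)}

theorem mon_mem_maximalIdeal_mul_of_lt {m n : Fin d →₀ ℕ} (hmn : m < n)
    {I : Ideal (ConvergentPowerSeries d)} (hm : mon m ∈ I) :
    mon n ∈ maximalIdeal (ConvergentPowerSeries d) * I := by
  rw [← tsub_add_cancel_of_le hmn.le, mon_add]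
  refine Ideal.mul_mem_mul ?_ hm
  rw [mem_maximalIdeal_iff, ← coeff_zero_eq_constantCoeff_apply, ← not_ne_iff,
    coeff_mon_ne_zero_iff, eq_comm, tsub_eq_zero_iff_le]
  exact hmn.not_ge

theorem mem_maximalIdeal_mul_monomialIdeal_iff {f : ConvergentPowerSeries d} :
    f ∈ maximalIdeal (ConvergentPowerSeries d) * monomialIdeal T ↔
      ∀ n, coeff n f.1 ≠ 0 → mon n ∈ maximalIdeal (ConvergentPowerSeries d) * monomialIdeal T := by
  simp only [maximalIdeal_eq_monomialIdeal, ← monomialIdeal_add, mon_mem_monomialIdeal_iff]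
  exact mem_monomialIdeal_iff

theorem mixedHilbertFunction_eq_card {s : ℕ} {J : Fin s → Ideal (ConvergentPowerSeries d)}
    {w : Fin (s + 1) → ℕ} {S : Finset (Fin d →₀ ℕ)} (hT : mixedPower J w = monomialIdeal T)
    (hS : ∀ n, n ∈ S ↔ mon n ∈ mixedPower J w ∧
      mon n ∉ maximalIdeal (ConvergentPowerSeries d) * mixedPower J w) :
    mixedHilbertFunction J w = S.card := by
  classical
  have hsupp {f : ConvergentPowerSeries d} (hf : f ∈ mixedPower J w) {n : Fin d →₀ ℕ}
      (hn : coeff n f.1 ≠ 0) : mon n ∈ mixedPower J w := by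
    rw [hT] at hf ⊢
    exact mon_mem_monomialIdeal_iff.mpr (mem_monomialIdeal_iff.mp hf n hn)
  have hminimal (n : S) (f : mixedPower J w) : ∀ m < n.1, coeff m f.1.1 = 0 := by
    intro m hmn
    by_contra hm
    exact ((hS n).mp n.2).2 (mon_mem_maximalIdeal_mul_of_lt hmn (hsupp f.2 hm))
  let φ : mixedPower J w →ₛₗ[evalZero d] S → ℂ :=
    { toFun := fun f n => coeff n.1 f.1.1
      map_add' := fun _ _ => rfl
      map_smul' := fun a f => funext fun n => coeff_mul_of_minimal (hminimal n f) a }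
  have hφmon (n k : S) : φ ⟨mon n.1, ((hS n).mp n.2).1⟩ k = if n = k then 1 else 0 := by
    simp only [eq_comm (a := n), ← Subtype.coe_inj]
    exact coeff_monomial k.1 n.1 1
  have hφ : Function.Surjective φ := by
    intro v
    choose a ha using evalZero_surjective (d := d)
    refine ⟨∑ n, a (v n) • ⟨mon n.1, ((hS n).mp n.2).1⟩, funext fun k => ?_⟩
    simp only [map_sum, map_smulₛₗ, ha, Finset.sum_apply, Pi.smul_apply, hφmon, smul_eq_mul,
      mul_ite, mul_one, mul_zero, Finset.sum_ite_eq', Finset.mem_univ, if_true]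
  have hker : LinearMap.ker φ = maximalIdeal (ConvergentPowerSeries d) • ⊤ := by
    ext f
    have hmem := mem_maximalIdeal_mul_monomialIdeal_iff (T := T) (f := f.1)
    rw [← hT] at hmem
    rw [LinearMap.mem_ker, Submodule.mem_smul_top_iff, smul_eq_mul, hmem]
    refine ⟨fun hf n hn => ?_, fun hf => funext fun n => ?_⟩
    · by_contra hn'
      exact hn (congrFun hf ⟨n, (hS n).mpr ⟨hsupp f.2 hn, hn'⟩⟩)
    · by_contra hn
      exact ((hS n).mp n.2).2 (hf n hn)
  rw [mixedHilbertFunction, finrank_quotient_smul_top_eq evalZero_surjective ker_evalZero φ hφ hker,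
    Module.finrank_fintype_fun_eq_card, Fintype.card_coe]

/-- The exponents of the monomials generating `𝔪^u J₁^{v₁} ⋯ J_s^{v_s}`, where `J_j` is the
monomial ideal with exponents `T j` and `w = (u, v₁, …, v_s)`. -/
def mixedExponents {s : ℕ} (T : Fin s → Set (Fin d →₀ ℕ)) (w : Fin (s + 1) → ℕ) :
    Set (Fin d →₀ ℕ) :=
  w 0 • variableExponents Set.univ + ∑ j, w j.succ • T j

variable {s : ℕ} {T : Fin s → Set (Fin d →₀ ℕ)} {w : Fin (s + 1) → ℕ}

theorem mixedPower_monomialIdeal (T : Fin s → Set (Fin d →₀ ℕ)) (w : Fin (s + 1) → ℕ) :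
    mixedPower (fun j => monomialIdeal (T j)) w = monomialIdeal (mixedExponents T w) := by
  simp only [mixedPower, mixedExponents, monomialIdeal_add, monomialIdeal_sum,
    monomialIdeal_nsmul, maximalIdeal_eq_monomialIdeal]

theorem mixedHilbertFunction_monomialIdeal {S : Finset (Fin d →₀ ℕ)}
    (hS : ∀ n, n ∈ S ↔ (∃ t ∈ mixedExponents T w, t ≤ n) ∧
      ¬ ∃ t ∈ mixedExponents T (w + Pi.single 0 1), t ≤ n) :
    mixedHilbertFunction (fun j => monomialIdeal (T j)) w = S.card := by
  refine mixedHilbertFunction_eq_card (mixedPower_monomialIdeal T w) fun n => ?_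
  rw [maximalIdeal_mul_mixedPower, mixedPower_monomialIdeal, mixedPower_monomialIdeal,
    mon_mem_monomialIdeal_iff, mon_mem_monomialIdeal_iff, hS]

end MonomialHilbertFunction

end ConvergentPowerSeries

/-! ### Exponents of three variables -/

section ExponentCount

variable {u a b p q r : ℕ}

/-- The number of factors `xz` in the most economical generator of `J₁ᵃ J₂ᵇ` (in the notation of
`mainTheorem7`) whose `x`- and `z`-exponents are at most `p` and `r`. It uses `a + b - p` factors
`y³z`, as few as the `x`-exponent permits. -/
def firstFactorCount (a b p r : ℕ) : ℕ :=
  min a (min (a + b - (a + b - p)) (r - (a + b - p)))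

/-- The number of factors `xz` or `xz²` in the generator of `firstFactorCount`. -/
def zFactorCount (a b p r : ℕ) : ℕ :=
  min (min (firstFactorCount a b p r + b) (a + b - (a + b - p)))
    ((r - (a + b - p) + firstFactorCount a b p r) / 2)

/-- The monomial `x^p y^q z^r` lies in `𝔪ᵘ J₁ᵃ J₂ᵇ`. Here `j` counts the factors `y³z`, `k` the
factors `xz` from `J₁` and `l` the factors `xz` or `xz²`, so that the corresponding generator of
`J₁ᵃ J₂ᵇ` has exponents `(a + b - j, 2(a + b) + j - 2l, j + 2l - k)`. -/
def MemProduct (u a b p q r : ℕ) : Prop :=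
  ∃ j k l, (k ≤ a ∧ k ≤ l ∧ l ≤ k + b ∧ j + l ≤ a + b) ∧
    (a + b ≤ p + j ∧ 2 * (a + b) + j ≤ q + 2 * l ∧ j + 2 * l ≤ r + k) ∧
    3 * (a + b) + j + u ≤ p + q + r + k

theorem memProduct_iff : MemProduct u a b p q r ↔
    a + b - p ≤ r ∧ 2 * (a + b) + (a + b - p) ≤ q + 2 * zFactorCount a b p r ∧
      3 * (a + b) + (a + b - p) + u ≤ p + q + r + firstFactorCount a b p r := by
  simp only [zFactorCount, firstFactorCount]
  constructor
  · rintro ⟨j, k, l, h⟩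
    omega
  · intro h
    refine ⟨_, firstFactorCount a b p r, zFactorCount a b p r, ?_, ⟨le_add_tsub, h.2.1, ?_⟩,
      h.2.2⟩ <;> simp only [zFactorCount, firstFactorCount] <;> omega

/-- The exponents of `z` that occur, next to `x ^ p`, in the monomials of `𝔪ᵘ J₁ᵃ J₂ᵇ` outside
`𝔪ᵘ⁺¹ J₁ᵃ J₂ᵇ`. -/
def zExponents (u a b p : ℕ) : Finset ℕ :=
  if p < a + b then Finset.Ico (a + b - p) (a + b - p + (2 * p + u + 1 - min a p))
  else if p < a + b + u then Finset.range (a + 2 * b + (a + b + u - p) + 1)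
  else Finset.range a ∪ (Finset.range (b + 1)).image fun e => a + 2 * e

theorem mem_zExponents_iff (hu : 1 ≤ u) : p ≤ a + b + u ∧ r ∈ zExponents u a b p ↔
    a + b - p ≤ r ∧ p + r + firstFactorCount a b p r ≤ a + b + u + 2 * zFactorCount a b p r := by
  simp only [zExponents, zFactorCount, firstFactorCount]
  split_ifs with h₁ h₂
  · simp only [Finset.mem_Ico]
    omega
  · simp only [Finset.mem_range]
    omega
  · simp only [Finset.mem_union, Finset.mem_image, Finset.mem_range]
    constructor
    · rintro ⟨hp, hr | ⟨e, he, rfl⟩⟩ <;> omega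
    · intro h
      refine ⟨by omega, or_iff_not_imp_left.mpr fun hr => ⟨(r - a) / 2, ?_, ?_⟩⟩ <;> omega

theorem memProduct_and_not_memProduct_succ_iff (hu : 1 ≤ u) :
    MemProduct u a b p q r ∧ ¬ MemProduct (u + 1) a b p q r ↔
      (p ≤ a + b + u ∧ r ∈ zExponents u a b p) ∧
        q = 3 * (a + b) + (a + b - p) + u - p - r - firstFactorCount a b p r := by
  rw [mem_zExponents_iff hu, memProduct_iff, memProduct_iff]
  have : zFactorCount a b p r ≤ a + b := by
    simp only [zFactorCount]
    omega
  omega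

theorem card_zExponents_of_lt (hp : p < a + b) :
    (zExponents u a b p).card + min a p = 2 * p + u + 1 := by
  rw [zExponents, if_pos hp, Nat.card_Ico]
  omega

theorem card_zExponents_add_of_lt {i : ℕ} (hi : i < u) :
    (zExponents u a b (a + b + i)).card = a + 2 * b + 1 + (u - i) := by
  rw [zExponents, if_neg (by omega), if_pos (by omega), Finset.card_range]
  omega

theorem card_zExponents_top : (zExponents u a b (a + b + u)).card = a + b + 1 := by
  rw [zExponents, if_neg (by omega), if_neg (by omega), Finset.card_union_of_disjoint,
    Finset.card_image_of_injective _ (fun e e' h => by simpa using h), Finset.card_range,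
    Finset.card_range, add_assoc]
  rw [Finset.disjoint_left]
  simp only [Finset.mem_range, Finset.mem_image]
  omega

theorem two_mul_sum_min_range_add (a b : ℕ) :
    2 * ∑ p ∈ Finset.range (a + b), min a p + a = a ^ 2 + 2 * a * b := by
  induction b with
  | zero =>
    rw [add_zero, Finset.sum_congr rfl fun p hp => min_eq_right (Finset.mem_range.mp hp).le,
      mul_comm, Finset.sum_range_id_mul_two, Nat.mul_sub_one,
      Nat.sub_add_cancel (Nat.le_mul_self a)]
    ring
  | succ b ih => rw [← add_assoc, Finset.sum_range_succ, min_eq_left (by omega)]; linarith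

theorem two_mul_sum_add_sub_range (c u : ℕ) :
    2 * ∑ i ∈ Finset.range u, (c + (u - i)) = 2 * u * c + u * (u + 1) := by
  induction u with
  | zero => simp
  | succ u ih =>
    simp only [Finset.sum_range_succ', Nat.add_sub_add_right, mul_add, ih, tsub_zero]
    ring

theorem sum_two_mul_add_range_add (n u : ℕ) :
    ∑ p ∈ Finset.range n, (2 * p + u + 1) + n = n * n + n * (u + 1) := by
  induction n with
  | zero => simp
  | succ n ih => rw [Finset.sum_range_succ]; linarith

theorem two_mul_sum_card_zExponents (u a b : ℕ) :
    2 * ∑ p ∈ Finset.range (a + b + u + 1), (zExponents u a b p).card + a + 4 * b =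
      (u + 1) * (u + 2) + 2 * (2 * a + 3 * b) * (u + 1) + a ^ 2 + 2 * a * b + 2 * b ^ 2 := by
  have hlow : ∑ p ∈ Finset.range (a + b), (zExponents u a b p).card +
      ∑ p ∈ Finset.range (a + b), min a p + (a + b) = (a + b) * (a + b) + (a + b) * (u + 1) := by
    rw [← Finset.sum_add_distrib, Finset.sum_congr rfl fun p hp =>
      card_zExponents_of_lt (Finset.mem_range.mp hp)]
    exact sum_two_mul_add_range_add (a + b) u
  rw [Finset.sum_range_succ, Finset.sum_range_add, card_zExponents_top,
    Finset.sum_congr rfl fun i hi => card_zExponents_add_of_lt (Finset.mem_range.mp hi)]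
  linarith [two_mul_sum_min_range_add a b, two_mul_sum_add_sub_range (a + 2 * b + 1) u]

end ExponentCount

namespace ConvergentPowerSeries

/-- The exponent of the monomial `x^p y^q z^r`. -/
noncomputable def expo (p q r : ℕ) : Fin 3 →₀ ℕ := Finsupp.equivFunOnFinite.symm ![p, q, r]

theorem expo_apply_eq (n : Fin 3 →₀ ℕ) : expo (n 0) (n 1) (n 2) = n := by
  ext i
  fin_cases i <;> rfl

theorem expo_inj {p q r p' q' r' : ℕ} :
    expo p q r = expo p' q' r' ↔ p = p' ∧ q = q' ∧ r = r' := by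
  simp [expo]

theorem expo_le_expo_iff {p q r p' q' r' : ℕ} :
    expo p q r ≤ expo p' q' r' ↔ p ≤ p' ∧ q ≤ q' ∧ r ≤ r' := by
  simp [expo, Finsupp.le_def, Fin.forall_fin_succ]

theorem expo_add (p q r p' q' r' : ℕ) :
    expo p q r + expo p' q' r' = expo (p + p') (q + q') (r + r') := by
  ext i
  fin_cases i <;> rfl

theorem nsmul_expo (k p q r : ℕ) : k • expo p q r = expo (k * p) (k * q) (k * r) := by
  ext i
  fin_cases i <;> rfl

theorem mem_nsmul_triple_iff {M : Type*} [AddCommMonoid M] {x y z m : M} {k : ℕ} :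
    m ∈ k • ({x, y, z} : Set M) ↔
      ∃ i j l, i + j + l = k ∧ i • x + j • y + l • z = m := by
  induction k generalizing m with
  | zero =>
    rw [zero_nsmul, Set.mem_zero]
    constructor
    · rintro rfl
      exact ⟨0, 0, 0, by simp⟩
    · rintro ⟨i, j, l, h, rfl⟩
      obtain ⟨rfl, rfl, rfl⟩ : i = 0 ∧ j = 0 ∧ l = 0 := by omega
      simp
  | succ k ih =>
    simp only [succ_nsmul, Set.mem_add, ih]
    constructor
    · rintro ⟨_, ⟨i, j, l, rfl, rfl⟩, _, rfl | rfl | rfl, rfl⟩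
      · exact ⟨i + 1, j, l, by ring, by rw [succ_nsmul]; abel⟩
      · exact ⟨i, j + 1, l, by ring, by rw [succ_nsmul]; abel⟩
      · exact ⟨i, j, l + 1, by ring, by rw [succ_nsmul]; abel⟩
    · rintro ⟨i, j, l, h, rfl⟩
      obtain ⟨i, rfl⟩ | ⟨j, rfl⟩ | ⟨l, rfl⟩ :
          (∃ i', i = i' + 1) ∨ (∃ j', j = j' + 1) ∨ ∃ l', l = l' + 1 := by
        cases i <;> cases j <;> cases l <;> simp_all
      · exact ⟨_, ⟨i, j, l, by omega, rfl⟩, x, by simp, by rw [succ_nsmul]; abel⟩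
      · exact ⟨_, ⟨i, j, l, by omega, rfl⟩, y, by simp, by rw [succ_nsmul]; abel⟩
      · exact ⟨_, ⟨i, j, l, by omega, rfl⟩, z, by simp, by rw [succ_nsmul]; abel⟩

/-- The exponents of the generators `xy²`, `y³z`, `xzᶜ`. -/
noncomputable def generatorExponents (c : ℕ) : Set (Fin 3 →₀ ℕ) :=
  {expo 1 2 0, expo 0 3 1, expo 1 0 c}

theorem mem_nsmul_generatorExponents_iff {k c : ℕ} {n : Fin 3 →₀ ℕ} :
    n ∈ k • generatorExponents c ↔
      ∃ i j l, i + j + l = k ∧ expo (i + l) (2 * i + 3 * j) (j + l * c) = n := by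
  simp only [generatorExponents, mem_nsmul_triple_iff, nsmul_expo, expo_add]
  simp only [mul_zero, mul_one, zero_add, add_zero, mul_comm]

theorem variableExponents_univ :
    variableExponents (Set.univ : Set (Fin 3)) = {expo 1 0 0, expo 0 1 0, expo 0 0 1} := by
  have single_eq : (fun i : Fin 3 => Finsupp.single i 1) =
      ![expo 1 0 0, expo 0 1 0, expo 0 0 1] := by
    ext i j
    fin_cases i <;> fin_cases j <;> simp [expo]
  simp [variableExponents, single_eq, Matrix.range_cons, Set.insert_comm, Set.pair_comm]

theorem mem_nsmul_variableExponents_univ_iff {k : ℕ} {n : Fin 3 →₀ ℕ} :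
    n ∈ k • variableExponents (Set.univ : Set (Fin 3)) ↔
      ∃ i j l, i + j + l = k ∧ expo i j l = n := by
  simp only [variableExponents_univ, mem_nsmul_triple_iff, nsmul_expo, expo_add]
  simp only [mul_zero, mul_one, zero_add, add_zero]

theorem exists_mem_le_expo_iff_memProduct {u a b p q r : ℕ} :
    (∃ t ∈ u • variableExponents Set.univ +
        (a • generatorExponents 1 + b • generatorExponents 2), t ≤ expo p q r) ↔
      MemProduct u a b p q r := by
  simp only [Set.mem_add, mem_nsmul_generatorExponents_iff, mem_nsmul_variableExponents_univ_iff]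
  constructor
  · rintro ⟨_, ⟨_, ⟨i, j, l, h, rfl⟩, _, ⟨_, ⟨i₁, j₁, l₁, h₁, rfl⟩, _, ⟨i₂, j₂, l₂, h₂, rfl⟩, rfl⟩,
      rfl⟩, hle⟩
    simp only [expo_add, expo_le_expo_iff] at hle
    exact ⟨j₁ + j₂, l₁, l₁ + l₂, by omega, by omega, by omega⟩
  · rintro ⟨j, k, l, hjkl, hle, hdeg⟩
    obtain ⟨j₁, j₂, rfl, hj₁, hj₂⟩ : ∃ j₁ j₂, j₁ + j₂ = j ∧ j₁ + k ≤ a ∧ j₂ + (l - k) ≤ b :=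
      ⟨min j (a - k), j - min j (a - k), by omega⟩
    obtain ⟨i₁, hi₁⟩ := Nat.exists_eq_add_of_le hj₁
    obtain ⟨i₂, hi₂⟩ := Nat.exists_eq_add_of_le hj₂
    -- The factor from `𝔪ᵘ` is chosen greedily: first powers of `x`, then of `y`, then of `z`.
    let P := i₁ + k + (i₂ + (l - k))
    let Q := 2 * i₁ + 3 * j₁ + (2 * i₂ + 3 * j₂)
    refine ⟨_, ⟨_, ⟨min u (p - P), min (u - min u (p - P)) (q - Q),
      u - min u (p - P) - min (u - min u (p - P)) (q - Q), by omega, rfl⟩, _, 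
      ⟨_, ⟨i₁, j₁, k, by omega, rfl⟩, _, ⟨i₂, j₂, l - k, by omega, rfl⟩, rfl⟩, rfl⟩, ?_⟩
    simp only [expo_add, expo_le_expo_iff]
    omega

/-- The ideal `(xy², y³z, xzᶜ)`, which for `c = 1` and `c = 2` is `J₁` and `J₂` respectively. -/
noncomputable def exampleIdeal (c : ℕ) : Ideal (ConvergentPowerSeries 3) :=
  Ideal.span {X 0 * X 1 ^ 2, X 1 ^ 3 * X 2, X 0 * X 2 ^ c}

theorem monomialIdeal_generatorExponents (c : ℕ) :
    monomialIdeal (generatorExponents c) = exampleIdeal c := by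
  have mon_expo (p q r : ℕ) :
      mon (expo p q r) = (X 0 ^ p * X 1 ^ q * X 2 ^ r : ConvergentPowerSeries 3) := by
    rw [mon_eq_prod, Fin.prod_univ_three]
    rfl
  simp [exampleIdeal, monomialIdeal, generatorExponents, Set.image_insert_eq, mon_expo]

/-- The exponents of the monomials in `𝔪ᵘ J₁ᵃ J₂ᵇ` but not in `𝔪ᵘ⁺¹ J₁ᵃ J₂ᵇ`. -/
noncomputable def minimalExponents (u a b : ℕ) : Finset (Fin 3 →₀ ℕ) :=
  ((Finset.range (a + b + u + 1)).sigma (zExponents u a b)).image fun x =>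
    expo x.1 (3 * (a + b) + (a + b - x.1) + u - x.1 - x.2 - firstFactorCount a b x.1 x.2) x.2

theorem expo_mem_minimalExponents_iff {u a b p q r : ℕ} (hu : 1 ≤ u) :
    expo p q r ∈ minimalExponents u a b ↔
      MemProduct u a b p q r ∧ ¬ MemProduct (u + 1) a b p q r := by
  rw [memProduct_and_not_memProduct_succ_iff hu]
  simp only [minimalExponents, Finset.mem_image, Finset.mem_sigma, Finset.mem_range,
    Sigma.exists, expo_inj, Nat.lt_succ_iff]
  constructor
  · rintro ⟨_, _, h, rfl, rfl, rfl⟩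
    exact ⟨h, rfl⟩
  · rintro ⟨h, rfl⟩
    exact ⟨p, r, h, rfl, rfl, rfl⟩

theorem card_minimalExponents (u a b : ℕ) :
    (minimalExponents u a b).card =
      ∑ p ∈ Finset.range (a + b + u + 1), (zExponents u a b p).card := by
  rw [minimalExponents, Finset.card_image_of_injective, Finset.card_sigma]
  rintro ⟨p, r⟩ ⟨p', r'⟩ h
  obtain ⟨rfl, -, rfl⟩ := expo_inj.mp h
  rfl

theorem two_mul_mixedHilbertFunction {s : ℕ} {J : Fin s → Ideal (ConvergentPowerSeries 3)}
    {c : Fin s → ℕ} (hJ : ∀ j, J j = exampleIdeal (c j)) {w : Fin (s + 1) → ℕ}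
    (hw : 1 ≤ w 0) {a b : ℕ}
    (hc : ∑ j, w j.succ • generatorExponents (c j) =
      a • generatorExponents 1 + b • generatorExponents 2) :
    2 * mixedHilbertFunction J w + a + 4 * b =
      (w 0 + 1) * (w 0 + 2) + 2 * (2 * a + 3 * b) * (w 0 + 1) + a ^ 2 + 2 * a * b + 2 * b ^ 2 := by
  obtain rfl : J = fun j => monomialIdeal (generatorExponents (c j)) :=
    funext fun j => by rw [hJ, monomialIdeal_generatorExponents]
  rw [← two_mul_sum_card_zExponents, ← card_minimalExponents, mixedHilbertFunction_monomialIdeal]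
  intro n
  simp only [mixedExponents, Pi.add_apply, Pi.single_eq_same, ne_eq, Fin.succ_ne_zero,
    not_false_eq_true, Pi.single_eq_of_ne, add_zero, hc]
  rw [← expo_apply_eq n, expo_mem_minimalExponents_iff hw, exists_mem_le_expo_iff_memProduct,
    exists_mem_le_expo_iff_memProduct]

end ConvergentPowerSeries

/-! ### Mixed multiplicities -/

theorem hasMixedMultiplicity_of_eq_sum {A : Type*} [CommRing A] [IsLocalRing A] {s : ℕ}
    {J : Fin s → Ideal A} {e : ℕ} (he : e ≠ 0) {ι : Type*} [Fintype ι] {E : ι → Fin (s + 1) → ℕ}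
    (hE : Function.Injective E) {c : ι → ℚ} {i : ι} (hdeg : ∀ j, ∑ l, E j l ≤ ∑ l, E i l)
    (hc : c i = e / ((∏ l, (E i l).factorial : ℕ) : ℚ)) {N : ℕ}
    (h : ∀ w, (∀ j, N ≤ w j) →
      (mixedHilbertFunction J w : ℚ) = ∑ j, c j * ∏ l, (w l : ℚ) ^ E j l) :
    HasMixedMultiplicity J (E i) e := by
  classical
  let P : MvPolynomial (Fin (s + 1)) ℚ :=
    ∑ j, MvPolynomial.monomial (Finsupp.equivFunOnFinite.symm (E j)) (c j)
  have coeff_P : P.coeff (Finsupp.equivFunOnFinite.symm (E i)) = c i := by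
    simp [P, MvPolynomial.coeff_sum, MvPolynomial.coeff_monomial, hE.eq_iff]
  refine ⟨P, ⟨N, fun w hw => ?_⟩, le_antisymm ?_ ?_, ?_⟩
  · simp [h w hw, P, MvPolynomial.eval_monomial, Finsupp.prod_fintype]
  · refine MvPolynomial.totalDegree_finsetSum_le fun j _ => ?_
    refine (MvPolynomial.totalDegree_monomial_le _ _).trans ?_
    simpa [Finsupp.sum_fintype] using hdeg j
  · have mem_support : Finsupp.equivFunOnFinite.symm (E i) ∈ P.support := by
      rw [MvPolynomial.mem_support_iff, coeff_P, hc]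
      have := Finset.prod_ne_zero_iff.mpr fun l (_ : l ∈ Finset.univ) => (E i l).factorial_ne_zero
      positivity
    simpa [Finsupp.sum_fintype] using MvPolynomial.le_totalDegree mem_support
  · exact coeff_P.trans hc

theorem hasMixedMultiplicity_of_quadratic {A : Type*} [CommRing A] [IsLocalRing A]
    {J : Fin 2 → Ideal A} {e : ℕ} (he : e ≠ 0) {c₀ c₁ c₂ c₁₁ c₂₂ l₀ l₁ l₂ k : ℚ} {N : ℕ}
    (h : ∀ w : Fin 3 → ℕ, (∀ j, N ≤ w j) → (mixedHilbertFunction J w : ℚ) =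
      c₀ * w 0 ^ 2 + c₁ * (w 0 * w 1) + c₂ * (w 0 * w 2) + c₁₁ * w 1 ^ 2 + e * (w 1 * w 2) +
        c₂₂ * w 2 ^ 2 + l₀ * w 0 + l₁ * w 1 + l₂ * w 2 + k) :
    HasMixedMultiplicity J ![0, 1, 1] e := by
  refine hasMixedMultiplicity_of_eq_sum he (ι := Fin 10) (i := 4) (N := N)
    (E := ![![2, 0, 0], ![1, 1, 0], ![1, 0, 1], ![0, 2, 0], ![0, 1, 1], ![0, 0, 2], ![1, 0, 0],
      ![0, 1, 0], ![0, 0, 1], ![0, 0, 0]]) (c := ![c₀, c₁, c₂, c₁₁, e, c₂₂, l₀, l₁, l₂, k])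
    (by decide) (by decide) ?_ fun w hw => ?_
  · simp [Fin.prod_univ_three]
  · rw [h w hw]
    simp [Fin.sum_univ_succ, Fin.prod_univ_three]
    ring

namespace ConvergentPowerSeries

theorem exists_card_eq_two_of_exampleIdeal_le {I : Ideal (ConvergentPowerSeries 3)}
    (hp : I.IsPrime) {c : ℕ} (hI : exampleIdeal c ≤ I) :
    ∃ S : Finset (Fin 3), S.card = 2 ∧ ∀ i ∈ S, X i ∈ I := by
  have h₁ : X 0 ∈ I ∨ X 1 ∈ I :=
    (hp.mem_or_mem (hI (Ideal.subset_span (by simp)))).imp_right (hp.mem_of_pow_mem 2)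
  have h₂ : X 1 ∈ I ∨ X 2 ∈ I :=
    (hp.mem_or_mem (hI (Ideal.subset_span (by simp)))).imp_left (hp.mem_of_pow_mem 3)
  have h₃ : X 0 ∈ I ∨ X 2 ∈ I :=
    (hp.mem_or_mem (hI (Ideal.subset_span (by simp)))).imp_right (hp.mem_of_pow_mem c)
  have pair {i j : Fin 3} (hij : i ≠ j) (hi : X i ∈ I) (hj : X j ∈ I) :
      ∃ S : Finset (Fin 3), S.card = 2 ∧ ∀ i ∈ S, X i ∈ I :=
    ⟨{i, j}, Finset.card_pair hij, by simp [hi, hj]⟩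
  rcases h₁ with h₀ | h₁
  · exact h₂.elim (pair (by decide) h₀) (pair (by decide) h₀)
  · exact h₃.elim (pair (by decide) h₁) (pair (by decide) h₁)

theorem height_exampleIdeal (c : ℕ) : (exampleIdeal c).height = 2 := by
  apply le_antisymm
  · have hle : exampleIdeal c ≤ monomialIdeal (variableExponents ({0, 1} : Finset (Fin 3))) := by
      have hX {i : Fin 3} (hi : i ∈ ({0, 1} : Finset (Fin 3))) :=
        X_mem_monomialIdeal_variableExponents_iff.mpr (Finset.mem_coe.mpr hi)
      rw [exampleIdeal, Ideal.span_le]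
      rintro _ (rfl | rfl | rfl)
      · exact Ideal.mul_mem_right _ _ (hX (by simp))
      · exact Ideal.mul_mem_right _ _ (Ideal.pow_mem_of_mem _ (hX (by simp)) 3 three_pos)
      · exact Ideal.mul_mem_right _ _ (hX (by simp))
    exact (Ideal.height_mono hle).trans_eq (height_monomialIdeal_variableExponents _)
  · rw [Ideal.height_eq_inf_minimalPrimes]
    refine le_iInf₂ fun I hI => ?_
    obtain ⟨S, hS, hSI⟩ := exists_card_eq_two_of_exampleIdeal_le hI.1.1 hI.1.2
    exact_mod_cast hS ▸ card_le_height_of_X_mem S hSI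

theorem hasMixedMultiplicity_exampleIdeal_one_one :
    HasMixedMultiplicity ![exampleIdeal 1, exampleIdeal 1] ![0, 1, 1] 1 := by
  refine hasMixedMultiplicity_of_quadratic one_ne_zero (c₀ := 1 / 2) (c₁ := 2) (c₂ := 2)
    (c₁₁ := 1 / 2) (c₂₂ := 1 / 2) (l₀ := 3 / 2) (l₁ := 3 / 2) (l₂ := 3 / 2) (k := 1) (N := 1)
    fun w hw => ?_
  have h := two_mul_mixedHilbertFunction (J := ![exampleIdeal 1, exampleIdeal 1]) (c := ![1, 1])
    (by simp [Fin.forall_fin_two]) (hw 0) (a := w 1 + w 2) (b := 0)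
    (by simp [Fin.sum_univ_two, add_nsmul])
  qify at h
  push_cast
  linarith

theorem hasMixedMultiplicity_exampleIdeal_one_two :
    HasMixedMultiplicity ![exampleIdeal 1, exampleIdeal 2] ![0, 1, 1] 1 := by
  refine hasMixedMultiplicity_of_quadratic one_ne_zero (c₀ := 1 / 2) (c₁ := 2) (c₂ := 3)
    (c₁₁ := 1 / 2) (c₂₂ := 1) (l₀ := 3 / 2) (l₁ := 3 / 2) (l₂ := 1) (k := 1) (N := 1)
    fun w hw => ?_
  have h := two_mul_mixedHilbertFunction (J := ![exampleIdeal 1, exampleIdeal 2]) (c := ![1, 2])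
    (by simp [Fin.forall_fin_two]) (hw 0) (a := w 1) (b := w 2)
    (by simp [Fin.sum_univ_two])
  qify at h
  push_cast
  linarith

theorem hasMixedMultiplicity_exampleIdeal_two_two :
    HasMixedMultiplicity ![exampleIdeal 2, exampleIdeal 2] ![0, 1, 1] 2 := by
  refine hasMixedMultiplicity_of_quadratic two_ne_zero (c₀ := 1 / 2) (c₁ := 3) (c₂ := 3)
    (c₁₁ := 1) (c₂₂ := 1) (l₀ := 3 / 2) (l₁ := 1) (l₂ := 1) (k := 1) (N := 1)
    fun w hw => ?_
  have h := two_mul_mixedHilbertFunction (J := ![exampleIdeal 2, exampleIdeal 2]) (c := ![2, 2])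
    (by simp [Fin.forall_fin_two]) (hw 0) (a := 0) (b := w 1 + w 2)
    (by simp [Fin.sum_univ_two, add_nsmul])
  qify at h
  push_cast
  linarith

theorem not_alexandrovFenchelForMixedMultiplicities :
    ¬ AlexandrovFenchelForMixedMultiplicities.{0} := by
  intro hAF
  have hcons : (Fin.cons 0 fun _ => 1 : Fin 3 → ℕ) = ![0, 1, 1] := by
    ext i
    fin_cases i <;> rfl
  have hle := hAF 0 (ConvergentPowerSeries 3) (ringKrullDim_eq 3) (exampleIdeal 1) (exampleIdeal 2)
    ![] (height_exampleIdeal 1) (height_exampleIdeal 2) (fun j => j.elim0) 1 1 2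
    (hcons ▸ hasMixedMultiplicity_exampleIdeal_one_one)
    (hcons ▸ hasMixedMultiplicity_exampleIdeal_one_two)
    (hcons ▸ hasMixedMultiplicity_exampleIdeal_two_two)
  norm_num at hle

end ConvergentPowerSeries

open ConvergentPowerSeries in
theorem mainTheorem7 (x y z : ConvergentPowerSeries 3)
    (hx : x = ConvergentPowerSeries.X 0) (hy : y = ConvergentPowerSeries.X 1)
    (hz : z = ConvergentPowerSeries.X 2) (J₁ J₂ : Ideal (ConvergentPowerSeries 3))
    (hJ₁ : J₁ = Ideal.span {x * y ^ 2, y ^ 3 * z, x * z})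
    (hJ₂ : J₂ = Ideal.span {x * y ^ 2, y ^ 3 * z, x * z ^ 2}) :
    (IsNoetherianRing (ConvergentPowerSeries 3) ∧ ringKrullDim (ConvergentPowerSeries 3) = 3) ∧
    (J₁.height = 2 ∧ J₂.height = 2) ∧
    HasMixedMultiplicity ![J₁, J₁] ![0, 1, 1] 1 ∧
    HasMixedMultiplicity ![J₁, J₂] ![0, 1, 1] 1 ∧
    HasMixedMultiplicity ![J₂, J₂] ![0, 1, 1] 2 ∧
    ¬ AlexandrovFenchelForMixedMultiplicities.{0} := by
  obtain rfl : J₁ = exampleIdeal 1 := by rw [hJ₁, hx, hy, hz, exampleIdeal, pow_one]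
  obtain rfl : J₂ = exampleIdeal 2 := by rw [hJ₂, hx, hy, hz, exampleIdeal]
  exact ⟨⟨inferInstance, ringKrullDim_eq 3⟩, ⟨height_exampleIdeal 1, height_exampleIdeal 2⟩,
    hasMixedMultiplicity_exampleIdeal_one_one, hasMixedMultiplicity_exampleIdeal_one_two,
    hasMixedMultiplicity_exampleIdeal_two_two, not_alexandrovFenchelForMixedMultiplicities⟩
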